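/- **Model.** A ring with $n\ge 3$ nodes $v_0,\dots,v_{n-1}$ and an edge between $v_i$ and $v_{i+1 \bmod n}$ carries three robots, placed on arbitrary (not necessarily distinct) nodes. Nodes are anonymous and there is no landmark. The robots have pairwise distinct IDs and run the same algorithm, which is given neither $n$ nor any bound on $n$; initially a robot knows only its own ID. Each robot names the two ports of every node "left" and "right" in its own fixed orientation; the orientations may differ from robot to robot (no chirality). In each round: (i) an adversary chooses the set of awake robots; each awake robot looks at its own state, at its port and at the robots at its node, obtains a fresh fair random bit, and computes its new memory and whether to stay, to try to move through one of its two ports, or to terminate; (ii) the adversary removes at most one edge (1-interval connectivity); (iii) every robot, awake or asleep, that is trying to move through an edge that is present moves over it; the others keep waiting at their ports, and move as soon as the edge is present, even if they are asleep by then (passive transport). Robots that cross each other on an edge, and robots that come together at a node (or start at the same node), detect this and swap their data, including whether they are waiting at a port and how their orientations are related, even if they are asleep (edge crossing detection). The adversary knows the algorithm and the whole history of the execution, but not future random bits; it must not let a robot sleep forever. For an execution let $f\in\mathbb N\cup\{\infty\}$ be the largest interval of time between two consecutive activations of a robot, where the start of the execution counts as an activation of every robot. **Theorem.** There are an algorithm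 and an absolute constant $K$ such that for every $n\ge 3$, all distinct IDs, all initial positions and orientations of the three robots, and every such adversary, with probability at least $3/4$ the ring is correctly explored with partial termination in at most $K f n$ steps: some robot terminates, no robot ever terminates before all nodes have been visited by the robots, and the total number of moves over edges made by the three robots up to some time at which a robot has terminated is at most $K f n$. Moreover, if the IDs are $k$-bit numbers, then every robot always uses at most $K(\log_2 n+k)$ bits of memory (with $\log_2 n$ rounded down), which is $O(\log n)$ for IDs of constant length. -/

import Mathlib

open scoped ENNReal

namespace DynamicRing

/-! ### The robots' algorithm

Each robot names the two ports of the node it is on by `false` ("left") and `true` ("right"), in its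
own private orientation, which is kept during the whole execution. -/

/-- What a robot learns about another robot with which it is in contact: the memory of the other
robot, the port (in the observer's own naming) on which the other robot is waiting for an edge, if
any, and whether the two robots name the ports in the same way. -/
abbrev Sighting (M : Type) : Type := M × Option Bool × Bool

/-- The outcome of a local computation: `none` is "terminate", `some none` is "stay at the node",
`some (some d)` is "try to move through port `d`". -/
abbrev Action : Type := Option (Option Bool)

/-- The protocol executed by every robot. It has no access to the size of the ring, to node names,
to the round number or to a global orientation. -/
structure Algorithm where
  /-- the possible memory contents -/
  Mem : Type
  /-- a numbering of the memory contents -/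
  [primcodable : Primcodable Mem]
  /-- the initial memory of a robot, which knows only its own ID -/
  init : ℕ → Mem
  /-- The local computation of an activated robot, from its memory, the port on which it is waiting
  (`none` if its last move succeeded or it did not try to move), the robots that it sees at its node
  (in order of their IDs) and a fresh random bit. -/
  act : Mem → Option Bool → List (Sighting Mem) → Bool → Mem × Action
  /-- The new memory of a robot, active or asleep, after it met other robots and swapped data with
  them. The Boolean tells whether they crossed on an edge (`true`) or came together at a node
  (`false`); the robots that are met are listed in order of their IDs. -/
  meet : Mem → Option Bool → Bool → List (Sighting Mem) → Mem
  init_computable : Computable init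
  act_computable : Computable
    (fun x : Mem × Option Bool × List (Sighting Mem) × Bool => act x.1 x.2.1 x.2.2.1 x.2.2.2)
  meet_computable : Computable
    (fun x : Mem × Option Bool × Bool × List (Sighting Mem) => meet x.1 x.2.1 x.2.2.1 x.2.2.2)

attribute [instance] Algorithm.primcodable

/-! ### The ring and the robots

The nodes of the ring are the elements of `ZMod n`; the edge `e` joins the nodes `e` and `e + 1`.
A global direction is a Boolean, `true` being the direction from `v` to `v + 1`. -/

/-- IDs, private orientations and initial nodes of the three robots. If `chir i = true`, robot `i`
calls "right" the global direction `true`, otherwise it calls "right" the direction `false`. -/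
structure Setup (n : ℕ) where
  ids : Fin 3 → ℕ
  ids_injective : Function.Injective ids
  chir : Fin 3 → Bool
  start : Fin 3 → ZMod n

/-- The condition of one robot. -/
structure Robot (n : ℕ) (M : Type) where
  /-- the node at which the robot is -/
  pos : ZMod n
  /-- the port (in the robot's own naming) through which it is trying to move, if any -/
  port : Option Bool
  mem : M
  /-- whether the robot has terminated -/
  halted : Bool
  /-- the number of random bits used so far -/
  coins : ℕ

abbrev Config (n : ℕ) (M : Type) : Type := Fin 3 → Robot n M

variable {n : ℕ}

/-- Translation between the port names of a robot with orientation `c` and global directions (in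
either way, since it is an involution). -/
def turn (c d : Bool) : Bool := c == d

/-- The edge that leaves the node `p` in the global direction `g`. -/
def edgeFrom (p : ZMod n) (g : Bool) : ZMod n := if g then p else p - 1

/-- The neighbour of the node `p` in the global direction `g`. -/
def neighbour (p : ZMod n) (g : Bool) : ZMod n := if g then p + 1 else p - 1

/-- Robot `j` as perceived by robot `i`. -/
def sight {M : Type} (S : Setup n) (c : Config n M) (i j : Fin 3) : Sighting M :=
  ((c j).mem, (c j).port.map (fun d => turn (S.chir i) (turn (S.chir j) d)),
    S.chir i == S.chir j)

/-- The robots `j` with `P j` as perceived by robot `i`, in order of their IDs. -/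
def sightings {M : Type} (S : Setup n) (c : Config n M) (i : Fin 3) (P : Fin 3 → Bool) :
    List (Sighting M) :=
  (((List.finRange 3).filter P).insertionSort (fun j k => S.ids j ≤ S.ids k)).map (sight S c i)

/-- Every robot `i` that has not terminated simultaneously swaps data with all robots `j` such that
`P i j`, if there are any. -/
def exchange (alg : Algorithm) (S : Setup n) (crossing : Bool) (P : Fin 3 → Fin 3 → Bool)
    (c : Config n alg.Mem) : Config n alg.Mem := fun i =>
  let l := sightings S c i (P i)
  if l.isEmpty || (c i).halted then c i
  else { c i with mem := alg.meet (c i).mem (c i).port crossing l }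

/-- The initial configuration. Robots that start at the same node meet there. -/
def initial (alg : Algorithm) (S : Setup n) : Config n alg.Mem :=
  exchange alg S false (fun i j => decide (i ≠ j) && decide (S.start i = S.start j))
    (fun i => ⟨S.start i, none, alg.init (S.ids i), false, 0⟩)

/-- The random bits: `ω (i, m)` is the bit that robot `i` obtains at its `m`-th local computation. -/
abbrev Coins : Type := Fin 3 × ℕ → Bool

/-- The law of independent fair coin tosses. -/
noncomputable def coinLaw : MeasureTheory.Measure Coins :=
  MeasureTheory.Measure.infinitePi (fun _ => (PMF.uniformOfFintype Bool).toMeasure)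

/-- First part of a round: the robots of the set `W` are awake and carry out their local
computations, all of them from the same configuration. -/
def compute (alg : Algorithm) (S : Setup n) (ω : Coins) (W : Finset (Fin 3))
    (c : Config n alg.Mem) : Config n alg.Mem := fun i =>
  if i ∈ W ∧ (c i).halted = false then
    let r := alg.act (c i).mem (c i).port
      (sightings S c i (fun j => decide (j ≠ i) && decide ((c j).pos = (c i).pos)))
      (ω (i, (c i).coins))
    match r.2 with
    | none => ⟨(c i).pos, none, r.1, true, (c i).coins + 1⟩
    | some p => ⟨(c i).pos, p, r.1, false, (c i).coins + 1⟩
  else c i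

/-- The edge over which robot `i` moves, and the global direction in which it does so, when the
edge `cut` (if any) is missing; `none` if robot `i` does not move. This does not depend on whether
robot `i` is awake: a robot on a port is transported as soon as the edge is present. -/
def traversal {M : Type} (S : Setup n) (cut : Option (ZMod n)) (c : Config n M) (i : Fin 3) :
    Option (ZMod n × Bool) :=
  (c i).port.bind fun d =>
    let g := turn (S.chir i) d
    let e := edgeFrom (c i).pos g
    if cut = some e then none else some (e, g)

/-- All robots whose edge is present move; the others keep waiting on their ports. -/
def relocate {M : Type} (S : Setup n) (cut : Option (ZMod n)) (c : Config n M) : Config n M :=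
  fun i =>
    match traversal S cut c i with
    | none => c i
    | some (_, g) => { c i with pos := neighbour (c i).pos g, port := none }

/-- Robots `i` and `j` pass each other on an edge. -/
def crossed {M : Type} (S : Setup n) (cut : Option (ZMod n)) (c : Config n M) (i j : Fin 3) :
    Bool :=
  match traversal S cut c i, traversal S cut c j with
  | some (e, g), some (e', g') => decide (e = e') && (g != g')
  | _, _ => false

/-- Robots `i` and `j` are at the same node after the moves, and at least one of them just arrived
there. -/
def joined {M : Type} (S : Setup n) (cut : Option (ZMod n)) (c : Config n M) (i j : Fin 3) :
    Bool :=
  decide (i ≠ j) && decide ((relocate S cut c i).pos = (relocate S cut c j).pos) &&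
    ((traversal S cut c i).isSome || (traversal S cut c j).isSome)

/-- Second part of a round, when the edge `cut` (if any) is missing: the robots move; those that
cross on an edge swap data, and then those that come together at a node do so. -/
def transport (alg : Algorithm) (S : Setup n) (cut : Option (ZMod n)) (c : Config n alg.Mem) :
    Config n alg.Mem :=
  exchange alg S false (joined S cut c)
    (exchange alg S true (crossed S cut c) (relocate S cut c))

/-! ### The adversary and the execution -/

/-- A strategy of the adversary. It may depend on the complete history of the execution, a list of
configurations with the latest one first. -/
structure Adversary (n : ℕ) (M : Type) where
  /-- which robots are awake in the next round -/
  wake : List (Config n M) → Finset (Fin 3)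
  /-- the edge (at most one) that is missing in the current round, chosen after the local
  computations of this round -/
  cut : List (Config n M) → Option (ZMod n)

section Execution

variable (alg : Algorithm) (S : Setup n) (adv : Adversary n alg.Mem) (ω : Coins)

/-- The configuration after `t` rounds, and the list of all earlier configurations, including those
in the middle of a round. -/
def exec : ℕ → Config n alg.Mem × List (Config n alg.Mem)
  | 0 => (initial alg S, [])
  | t + 1 =>
    let c := (exec t).1
    let h := (exec t).2
    let m := compute alg S ω (adv.wake (c :: h)) c
    (transport alg S (adv.cut (m :: c :: h)) m, m :: c :: h)

/-- The configuration after `t` rounds. -/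
def config (t : ℕ) : Config n alg.Mem := (exec alg S adv ω t).1

/-- The robots that are awake in the round that leads from time `t` to time `t + 1`. -/
def awake (t : ℕ) : Finset (Fin 3) :=
  adv.wake ((exec alg S adv ω t).1 :: (exec alg S adv ω t).2)

/-- Robot `i` is activated in round `r`; rounds are numbered from `1`, and the start of the
execution, `r = 0`, counts as an activation. -/
def ActivatedIn (i : Fin 3) : ℕ → Prop
  | 0 => True
  | t + 1 => i ∈ awake alg S adv ω t

/-- No robot remains asleep forever. -/
def IsFair : Prop := ∀ i t, ∃ s, t ≤ s ∧ i ∈ awake alg S adv ω s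

/-- The largest interval of time between two consecutive activations of a robot. -/
noncomputable def activationGap : ℕ∞ :=
  ⨆ (i : Fin 3) (r : ℕ) (r' : ℕ) (_ : r < r' ∧ ActivatedIn alg S adv ω i r ∧
    ActivatedIn alg S adv ω i r' ∧ ∀ q, r < q → q < r' → ¬ ActivatedIn alg S adv ω i q),
    ((r' - r : ℕ) : ℕ∞)

/-- Every node has been visited by a robot by time `t`. -/
def ExploredBy (t : ℕ) : Prop := ∀ v : ZMod n, ∃ s ≤ t, ∃ i, (config alg S adv ω s i).pos = v

/-- Some robot has terminated by time `t`. -/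
def TerminatedBy (t : ℕ) : Prop := ∃ i, (config alg S adv ω t i).halted = true

/-- The total number of steps (moves over an edge) that the robots make up to time `t`. -/
def steps (t : ℕ) : ℕ :=
  ∑ s ∈ Finset.range t, (Finset.univ.filter fun i =>
    (config alg S adv ω (s + 1) i).pos ≠ (config alg S adv ω s i).pos).card

/-- Correct exploration with partial termination in at most `b` steps: a robot terminates only in a
round at whose beginning all nodes have been visited, and some robot does terminate, at a time at
which the robots have made at most `b` steps. -/
def ExploresWithin (b : ℕ∞) : Prop :=
  (∀ t, TerminatedBy alg S adv ω (t + 1) → ExploredBy alg S adv ω t) ∧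
    ∃ t, TerminatedBy alg S adv ω t ∧ (steps alg S adv ω t : ℕ∞) ≤ b

end Execution

end DynamicRing

/-! A robot uses at most one random bit, the one of its first activation, to choose a direction in
which it walks. When two robots meet while nobody explores, two of the robots become explorers in
opposite directions, and the nodes between them form a growing arc of visited nodes; the third robot
becomes a walker that turns around whenever it meets an explorer. If the explorers come together on
the far side, the arc is the whole ring. Otherwise the adversary must at some time make both
explorers wait after the same round of moves. Only one edge is missing in that round, so they wait
at its two ends, and again the arc contains all nodes.

The walker detects the second case. An explorer remembers whether it has been waiting ever since the
walker met it, and the walker remembers whether the last explorer it met was waiting. If the walker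
meets a waiting explorer, then the other one, also waiting, then the first again, which has waited
throughout, both explorers were waiting at the middle meeting. This is the field `Duo.confirmed`,
and it makes termination safe.

Robots can fail to meet only if all three walk in the same global direction. Their first bits
produce this with probability 2/8 at most (`three_quarters_le_mixed`), whatever the adversary does,
since those bits are fixed coordinates of `ω`. If the directions are mixed (`Mixed`), exactly one
robot `z` walks against the other two (`Trio`). These two stand on different nodes, so one missing
edge cannot stop both, and every move shortens a distance to `z` until there is a meeting.

For mixed directions the rest is deterministic. Every configuration of the execution is `Good`: it
has a rank of at most `13 * n` and a distinguished robot. In each round of positive rank, either the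
rank drops, or the distinguished robot sleeps and both stay as they are (`Good.step`). The rank
combines distances between walkers, the unexplored part of the ring, the number of robots not
waiting on a port, and the meetings and steps still needed by the walker. Hence the rank drops in
every time window in which all robots are activated. With windows of length `f` termination comes
within `13 * n * f` rounds of at most three moves each. -/

namespace DynamicRing

/-! ### The algorithm -/

/-- The part of the memory of a robot besides its ID; directions are in the robot's own naming. -/
inductive Role where
  /-- nothing has happened yet -/
  | fresh
  /-- walking in direction `d`; `f` tells whether the last explorer that was met was waiting -/
  | walk (d f : Bool)
  /-- exploring in direction `d`; `u` tells whether the robot has been waiting ever since it was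
  met by the walking robot -/
  | explore (d u : Bool)
  /-- the ring is explored -/
  | finished
  deriving DecidableEq, Fintype

namespace Role

noncomputable instance : Primcodable Role := Primcodable.ofEquiv _ (Fintype.equivFin Role)

/-- Change of the naming of the ports. -/
def turned (s : Bool) : Role → Role
  | fresh => fresh
  | walk d f => walk (turn s d) f
  | explore d u => explore (turn s d) u
  | finished => finished

/-- The direction of an explorer. -/
def explores : Role → Option Bool
  | explore d _ => some d
  | _ => none

/-- The action prescribed by a role. -/
def action : Role → Action
  | fresh => some none
  | walk d _ => some (some d)
  | explore d _ => some (some d)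
  | finished => none

/-- Whether the role is that of a robot that is neither an explorer nor finished. -/
def wanders : Role → Bool
  | fresh => true
  | walk _ _ => true
  | _ => false

end Role

/-- What a robot uses of a sighting: whether the other ID is smaller, the role and the port of the
other robot, and whether the orientations agree. -/
abbrev Info : Type := Bool × Role × Option Bool × Bool

/-- The information in a sighting for the robot `id`. -/
def info (id : ℕ) (s : Sighting (ℕ × Role)) : Info :=
  (decide (s.1.1 < id), s.1.2.turned s.2.2, s.2.1, s.2.2)

/-- The information in the first two sightings. -/
def infos (id : ℕ) (l : List (Sighting (ℕ × Role))) : Option Info × Option Info :=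
  (l.head?.map (info id), l.tail.head?.map (info id))

/-- A walking robot turns around when it sees an explorer with its own direction. -/
def Role.proceed (l : List Info) (d f : Bool) : Role :=
  if l.any (fun s => s.2.1.explores == some d) then .walk (!d) false else .walk d f

/-- The new role of an activated robot. -/
def Role.next (r : Role) (p : Option Bool) (l : List Info) (coin : Bool) : Role :=
  match r with
  | .fresh => Role.proceed l coin false
  | .walk d f => Role.proceed l d f
  | .explore d u => .explore d (u && p.isSome)
  | .finished => .finished

/-- The order in which robots that come together get their roles: first those that wait on a port,
then those with smaller IDs. -/
def precedes (p : Option Bool) (s : Info) : Bool :=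
  (s.2.2.1.isSome && p.isNone) || ((s.2.2.1.isSome == p.isSome) && s.1)

/-- The role that is taken by a robot that comes together with robots none of which explores. -/
def Role.found (p : Option Bool) (l : List Info) : Role :=
  match l.filter (precedes p) with
  | [] => .explore (p.getD true) false
  | [s] => .explore (!(s.2.2.1.getD s.2.2.2)) false
  | _ => .walk true false

/-- The new role of a robot that is not yet an explorer when it meets other robots. -/
def Role.join (r : Role) (p : Option Bool) (crossing : Bool) (l : List Info) : Role :=
  match l with
  | [(_, .explore d u, q, _)] =>
    if r = .walk d true ∧ u = true ∧ q.isSome = true then .finished else .walk (!d) q.isSome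
  | l =>
    if l.any (fun s => s.2.1.explores.isSome) then .walk true false
    else if crossing then
      match r with
      | .walk d _ => .explore d false
      | r => r
    else Role.found p l

/-- The new role of a robot that meets other robots. -/
def Role.encounter (r : Role) (p : Option Bool) (crossing : Bool) (l : List Info) : Role :=
  match r with
  | .finished => .finished
  | .explore d _ =>
    if l.any (fun s => s.2.1.explores.isSome) then .finished else .explore d p.isSome
  | r => r.join p crossing l

/-- The local computation. -/
def ringAct (m : ℕ × Role) (p : Option Bool) (l : List (Sighting (ℕ × Role))) (coin : Bool) :
    (ℕ × Role) × Action :=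
  let r := m.2.next p ((infos m.1 l).1.toList ++ (infos m.1 l).2.toList) coin
  ((m.1, r), r.action)

/-- The reaction to a meeting. -/
def ringMeet (m : ℕ × Role) (p : Option Bool) (crossing : Bool)
    (l : List (Sighting (ℕ × Role))) : ℕ × Role :=
  (m.1, m.2.encounter p crossing ((infos m.1 l).1.toList ++ (infos m.1 l).2.toList))

/-! ### Computability of the protocol. -/

theorem info_primrec : Primrec₂ info := by
  have hid : Primrec (fun x : ℕ × Sighting (ℕ × Role) => decide (x.2.1.1 < x.1)) :=
    PrimrecRel.decide (R := fun a b : ℕ => a < b) Primrec.nat_lt |>.comp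
      (Primrec.fst.comp (Primrec.fst.comp Primrec.snd)) Primrec.fst
  have hrole : Primrec (fun x : ℕ × Sighting (ℕ × Role) => x.2.1.2.turned x.2.2.2) :=
    (Primrec.dom_finite (fun y : Role × Bool => y.1.turned y.2)).comp
      (Primrec.pair (Primrec.snd.comp (Primrec.fst.comp Primrec.snd))
        (Primrec.snd.comp (Primrec.snd.comp Primrec.snd)))
  exact Primrec.pair hid (Primrec.pair hrole (Primrec.snd.comp Primrec.snd))

theorem infos_primrec : Primrec₂ infos := by
  have hinfo : Primrec₂ (fun (x : ℕ × List (Sighting (ℕ × Role))) s => info x.1 s) :=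
    info_primrec.comp (Primrec.fst.comp Primrec.fst) Primrec.snd
  exact Primrec.pair
    (Primrec.option_map (Primrec.list_head?.comp Primrec.snd) hinfo)
    (Primrec.option_map (Primrec.list_head?.comp (Primrec.list_tail.comp Primrec.snd)) hinfo)

/-- The protocol depends on IDs only through comparisons and reads at most two sightings. After
`infos` everything lives in a finite type, where every function is primitive recursive
(`Primrec.dom_finite`). -/
theorem ringAct_primrec : Primrec
    (fun x : (ℕ × Role) × Option Bool × List (Sighting (ℕ × Role)) × Bool =>
      ringAct x.1 x.2.1 x.2.2.1 x.2.2.2) := by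
  have hinfos : Primrec
      (fun x : (ℕ × Role) × Option Bool × List (Sighting (ℕ × Role)) × Bool =>
        infos x.1.1 x.2.2.1) :=
    infos_primrec.comp (Primrec.fst.comp Primrec.fst)
      (Primrec.fst.comp (Primrec.snd.comp Primrec.snd))
  have hrole : Primrec
      (fun x : (ℕ × Role) × Option Bool × List (Sighting (ℕ × Role)) × Bool =>
        x.1.2.next x.2.1 ((infos x.1.1 x.2.2.1).1.toList ++ (infos x.1.1 x.2.2.1).2.toList)
          x.2.2.2) :=
    (Primrec.dom_finite
      (fun y : Role × Option Bool × (Option Info × Option Info) × Bool =>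
        y.1.next y.2.1 (y.2.2.1.1.toList ++ y.2.2.1.2.toList) y.2.2.2)).comp
      (Primrec.pair (Primrec.snd.comp Primrec.fst)
        (Primrec.pair (Primrec.fst.comp Primrec.snd)
          (Primrec.pair hinfos (Primrec.snd.comp (Primrec.snd.comp Primrec.snd)))))
  exact Primrec.pair (Primrec.pair (Primrec.fst.comp Primrec.fst) hrole)
    ((Primrec.dom_finite Role.action).comp hrole)

theorem ringMeet_primrec : Primrec
    (fun x : (ℕ × Role) × Option Bool × Bool × List (Sighting (ℕ × Role)) =>
      ringMeet x.1 x.2.1 x.2.2.1 x.2.2.2) := by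
  have hinfos : Primrec
      (fun x : (ℕ × Role) × Option Bool × Bool × List (Sighting (ℕ × Role)) =>
        infos x.1.1 x.2.2.2) :=
    infos_primrec.comp (Primrec.fst.comp Primrec.fst)
      (Primrec.snd.comp (Primrec.snd.comp Primrec.snd))
  have hrole : Primrec
      (fun x : (ℕ × Role) × Option Bool × Bool × List (Sighting (ℕ × Role)) =>
        x.1.2.encounter x.2.1 x.2.2.1
          ((infos x.1.1 x.2.2.2).1.toList ++ (infos x.1.1 x.2.2.2).2.toList)) :=
    (Primrec.dom_finite
      (fun y : Role × Option Bool × Bool × (Option Info × Option Info) =>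
        y.1.encounter y.2.1 y.2.2.1 (y.2.2.2.1.toList ++ y.2.2.2.2.toList))).comp
      (Primrec.pair (Primrec.snd.comp Primrec.fst)
        (Primrec.pair (Primrec.fst.comp Primrec.snd)
          (Primrec.pair (Primrec.fst.comp (Primrec.snd.comp Primrec.snd)) hinfos)))
  exact Primrec.pair (Primrec.fst.comp Primrec.fst) hrole

/-- The exploration algorithm. -/
@[reducible] noncomputable def ringAlgorithm : Algorithm where
  Mem := ℕ × Role
  init id := (id, .fresh)
  act := ringAct
  meet := ringMeet
  init_computable := (Primrec.pair Primrec.id (Primrec.const _)).to_comp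
  act_computable := ringAct_primrec.to_comp
  meet_computable := ringMeet_primrec.to_comp

/-- The memory contents of a robot with a `k`-bit ID are small. -/
theorem size_encode_le {k : ℕ} {m : ℕ × Role} (h : m.1 < 2 ^ k) :
    Nat.size (Encodable.encode m) ≤ 2 * k + 8 := by
  -- There are ten roles: `fresh`, `finished`, and four each of `walk` and `explore`.
  have hr : Encodable.encode m.2 < 2 ^ 4 := by
    have : Encodable.encode m.2 = (Fintype.equivFin Role m.2 : ℕ) := rfl
    rw [this]
    exact lt_of_lt_of_le (Fin.is_lt _) (by decide)
  rw [Nat.size_le]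
  have hp : Encodable.encode m = Nat.pair m.1 (Encodable.encode m.2) := rfl
  rw [hp]
  refine lt_of_lt_of_le (Nat.pair_lt_max_add_one_sq _ _) ?_
  have h1 : (2:ℕ) ^ k ≤ 2 ^ (k + 4) := Nat.pow_le_pow_right (by norm_num) (by omega)
  have h2 : (2:ℕ) ^ 4 ≤ 2 ^ (k + 4) := Nat.pow_le_pow_right (by norm_num) (by omega)
  have h3 : max m.1 (Encodable.encode m.2) + 1 ≤ 2 ^ (k + 4) := by
    rcases max_cases m.1 (Encodable.encode m.2) with h | h <;> omega
  calc _ ≤ (2 ^ (k + 4)) ^ 2 := Nat.pow_le_pow_left h3 2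
    _ = 2 ^ (2 * k + 8) := by rw [← pow_mul]; congr 1; ring

section

variable {n : ℕ}

/-! ### Global directions -/

@[simp] theorem turn_turn (c d : Bool) : turn c (turn c d) = d := by cases c <;> cases d <;> rfl

@[simp] theorem turn_not (c d : Bool) : turn c (!d) = !turn c d := by cases c <;> cases d <;> rfl

-- The bit telling whether two orientations agree translates port names from one robot to the other;
-- this is why `Sighting` suffices to work with global directions.
@[simp] theorem turn_beq (a b d : Bool) : turn (a == b) (turn b d) = turn a d := by
  cases a <;> cases b <;> cases d <;> rfl

theorem turn_comp_turn (c : Bool) : turn c ∘ turn c = id := by funext d; simp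

theorem turn_injective (c : Bool) : Function.Injective (turn c) := fun a b h => by
  simpa using congrArg (turn c) h

@[simp] theorem turn_inj (c a b : Bool) : turn c a = turn c b ↔ a = b :=
  (turn_injective c).eq_iff

@[simp] theorem Role.turned_fresh (c : Bool) : Role.fresh.turned c = .fresh := rfl

@[simp] theorem Role.turned_walk (c d f : Bool) :
    (Role.walk d f).turned c = .walk (turn c d) f := rfl

@[simp] theorem Role.turned_explore (c d u : Bool) :
    (Role.explore d u).turned c = .explore (turn c d) u := rfl

@[simp] theorem Role.turned_finished (c : Bool) : Role.finished.turned c = .finished := rfl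

@[simp] theorem Role.turned_turned (c : Bool) (r : Role) : (r.turned c).turned c = r := by
  cases r <;> simp

@[simp] theorem Role.turned_beq (a b : Bool) (r : Role) :
    (r.turned b).turned (a == b) = r.turned a := by
  cases r <;> simp

@[simp] theorem Role.explores_turned (c : Bool) (r : Role) :
    (r.turned c).explores = r.explores.map (turn c) := by
  cases r <;> simp [Role.explores]

@[simp] theorem Role.wanders_turned (c : Bool) (r : Role) : (r.turned c).wanders = r.wanders := by
  cases r <;> rfl

theorem Role.explores_of_wanders {r : Role} (h : r.wanders = true) : r.explores = none := by
  cases r <;> simp_all [Role.wanders, Role.explores]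

/-- The role of robot `i`, with global directions. -/
def gr (S : Setup n) (c : Config n (ℕ × Role)) (i : Fin 3) : Role :=
  (c i).mem.2.turned (S.chir i)

/-- The global direction in which robot `i` tries to move. -/
def gp (S : Setup n) (c : Config n (ℕ × Role)) (i : Fin 3) : Option Bool :=
  (c i).port.map (turn (S.chir i))

variable {S : Setup n} {c : Config n (ℕ × Role)}

theorem role_eq (S : Setup n) (c : Config n (ℕ × Role)) (i : Fin 3) :
    (c i).mem.2 = (gr S c i).turned (S.chir i) := by simp [gr]

theorem port_eq (S : Setup n) (c : Config n (ℕ × Role)) (i : Fin 3) :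
    (c i).port = (gp S c i).map (turn (S.chir i)) := by
  simp [gp, turn_comp_turn]

theorem gr_congr {c' : Config n (ℕ × Role)} {i : Fin 3} (h : c' i = c i) :
    gr S c' i = gr S c i := by simp [gr, h]

theorem gp_congr {c' : Config n (ℕ × Role)} {i : Fin 3} (h : c' i = c i) :
    gp S c' i = gp S c i := by simp [gp, h]

/-- What robot `i` uses about robot `j`. -/
def view (S : Setup n) (c : Config n (ℕ × Role)) (i j : Fin 3) : Info :=
  info (c i).mem.1 (sight S c i j)

/-- A view consists of global data read in the orientation of the observer. The lemmas about
meetings can therefore be stated with `gr` and `gp` alone. -/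
theorem view_eq (S : Setup n) (c : Config n (ℕ × Role)) (i j : Fin 3) :
    view S c i j = (decide ((c j).mem.1 < (c i).mem.1), (gr S c j).turned (S.chir i),
      (gp S c j).map (turn (S.chir i)), S.chir i == S.chir j) := by
  have : (c j).mem.2.turned (S.chir i == S.chir j) = (gr S c j).turned (S.chir i) := by
    rw [role_eq S c j, Role.turned_beq]
  simp only [view, info, sight, this, gp, Option.map_map]
  rfl

theorem perm_finRange_three {i j k : Fin 3} (hij : i ≠ j) (hik : i ≠ k) (hjk : j ≠ k) :
    (List.finRange 3).Perm [i, j, k] := by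
  revert i j k; decide

theorem sightings_perm {i j k : Fin 3} (hij : i ≠ j) (hik : i ≠ k) (hjk : j ≠ k)
    (l : Fin 3) (P : Fin 3 → Bool) :
    (sightings S c l P).Perm (([i, j, k].filter P).map (sight S c l)) :=
  List.Perm.map _ ((List.perm_insertionSort _ _).trans
    ((perm_finRange_three hij hik hjk).filter P))

theorem sightings_none {i : Fin 3} {P : Fin 3 → Bool} (h : ∀ j, P j = false) :
    sightings S c i P = [] := by
  have : (List.finRange 3).filter P = [] := by simp [h]
  rw [sightings, this]
  rfl

theorem sightings_one {i j k : Fin 3} (hij : i ≠ j) (hik : i ≠ k) (hjk : j ≠ k)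
    {P : Fin 3 → Bool} (hi : P i = false) (hj : P j = true) (hk : P k = false) :
    sightings S c i P = [sight S c i j] := by
  have := sightings_perm (S := S) (c := c) hij hik hjk i P
  simpa [hi, hj, hk] using this

/-- The order by IDs is deliberately forgotten: the reaction to two sightings never depends on their
order. -/
theorem sightings_two {i j k : Fin 3} (hij : i ≠ j) (hik : i ≠ k) (hjk : j ≠ k)
    {P : Fin 3 → Bool} (hi : P i = false) (hj : P j = true) (hk : P k = true) :
    sightings S c i P = [sight S c i j, sight S c i k] ∨
      sightings S c i P = [sight S c i k, sight S c i j] := by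
  have := sightings_perm (S := S) (c := c) hij hik hjk i P
  simp only [hi, hj, hk, List.filter_cons, List.filter_nil, if_true, Bool.false_eq_true, if_false,
    List.map_cons, List.map_nil] at this
  generalize sightings S c i P = l at *
  match l, this with
  | [], h => simpa using h.length_eq
  | [a], h => simpa using h.length_eq
  | [a, b], h =>
    have ha : a ∈ [sight S c i j, sight S c i k] := h.mem_iff.1 (by simp)
    simp only [List.mem_cons, List.not_mem_nil, or_false] at ha
    rcases ha with rfl | rfl
    · left; simpa using h
    · right
      have := h.trans (List.Perm.swap _ _ [])
      simpa using this
  | a :: b :: d :: l, h => simpa using h.length_eq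

/-! ### Meetings -/

variable {x : Bool} {P : Fin 3 → Fin 3 → Bool}

/-- The configuration after a swap of data. -/
noncomputable abbrev swapped (S : Setup n) (x : Bool) (P : Fin 3 → Fin 3 → Bool) (c : Config n (ℕ × Role)) :
    Config n (ℕ × Role) := exchange ringAlgorithm S x P c

@[simp] theorem swapped_pos (i : Fin 3) : (swapped S x P c i).pos = (c i).pos := by
  simp only [swapped, exchange]; split <;> rfl

@[simp] theorem swapped_port (i : Fin 3) : (swapped S x P c i).port = (c i).port := by
  simp only [swapped, exchange]; split <;> rfl

@[simp] theorem swapped_halted (i : Fin 3) : (swapped S x P c i).halted = (c i).halted := by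
  simp only [swapped, exchange]; split <;> rfl

@[simp] theorem swapped_id (i : Fin 3) : (swapped S x P c i).mem.1 = (c i).mem.1 := by
  simp only [swapped, exchange]; split <;> rfl

@[simp] theorem swapped_gp (i : Fin 3) : gp S (swapped S x P c) i = gp S c i := by
  simp [gp]

theorem swapped_alone {i : Fin 3} (h : ∀ j, P i j = false) : swapped S x P c i = c i := by
  simp [swapped, exchange, sightings_none h]

theorem swapped_finished {i : Fin 3} (h : gr S c i = .finished) :
    gr S (swapped S x P c) i = .finished := by
  have hr : (c i).mem.2 = .finished := by rw [role_eq S c, h]; rfl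
  simp only [gr, swapped, exchange]
  split
  · exact h
  · simp [ringMeet, hr, Role.encounter]

theorem swapped_one {i j k : Fin 3} (hij : i ≠ j) (hik : i ≠ k) (hjk : j ≠ k)
    (hi : P i i = false) (hj : P i j = true) (hk : P i k = false) (hh : (c i).halted = false) :
    gr S (swapped S x P c) i = (((gr S c i).turned (S.chir i)).encounter
      ((gp S c i).map (turn (S.chir i))) x [view S c i j]).turned (S.chir i) := by
  rw [← role_eq, ← port_eq]
  simp [gr, swapped, exchange, sightings_one hij hik hjk hi hj hk, hh, ringMeet, infos, view]

theorem swapped_two {i j k : Fin 3} (hij : i ≠ j) (hik : i ≠ k) (hjk : j ≠ k)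
    (hi : P i i = false) (hj : P i j = true) (hk : P i k = true) (hh : (c i).halted = false) :
    ∃ l, (l = [view S c i j, view S c i k] ∨ l = [view S c i k, view S c i j]) ∧
    gr S (swapped S x P c) i = (((gr S c i).turned (S.chir i)).encounter
      ((gp S c i).map (turn (S.chir i))) x l).turned (S.chir i) := by
  rw [← role_eq, ← port_eq]
  rcases sightings_two (S := S) (c := c) hij hik hjk hi hj hk with h | h
  · refine ⟨_, Or.inl rfl, ?_⟩
    simp [gr, swapped, exchange, h, hh, ringMeet, infos, view]
  · refine ⟨_, Or.inr rfl, ?_⟩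
    simp [gr, swapped, exchange, h, hh, ringMeet, infos, view]

/-- An explorer that meets an explorer knows that the ring is explored. -/
theorem swapped_explorers {i j k : Fin 3} (hij : i ≠ j) (hik : i ≠ k) (hjk : j ≠ k)
    (hi : P i i = false) (hj : P i j = true) (hh : (c i).halted = false) {g g' u u' : Bool}
    (hri : gr S c i = .explore g u) (hrj : gr S c j = .explore g' u') :
    gr S (swapped S x P c) i = .finished := by
  cases hk : P i k
  · rw [swapped_one hij hik hjk hi hj hk hh, view_eq, hri, hrj]
    simp [Role.encounter, Role.explores]
  · obtain ⟨l, hl, h⟩ := swapped_two (x := x) hij hik hjk hi hj hk hh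
    rw [h, hri]
    rcases hl with rfl | rfl <;> simp [view_eq, hrj, Role.encounter, Role.explores]

/-- An explorer that meets only a robot that does not explore. -/
theorem swapped_explorer {i j k : Fin 3} (hij : i ≠ j) (hik : i ≠ k) (hjk : j ≠ k)
    (hi : P i i = false) (hj : P i j = true) (hk : P i k = false) (hh : (c i).halted = false)
    {g u : Bool} (hri : gr S c i = .explore g u) (hrj : (gr S c j).explores = none) :
    gr S (swapped S x P c) i = .explore g (gp S c i).isSome := by
  rw [swapped_one hij hik hjk hi hj hk hh, view_eq, hri]
  simp [Role.encounter, hrj]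

theorem Role.encounter_of_wanders {r : Role} (h : r.wanders = true) (p : Option Bool) (x : Bool)
    (l : List Info) : r.encounter p x l = r.join p x l := by
  cases r <;> simp_all [Role.wanders, Role.encounter]

/-- A walking robot that meets one explorer. -/
theorem swapped_walker {i j k : Fin 3} (hij : i ≠ j) (hik : i ≠ k) (hjk : j ≠ k)
    (hi : P i i = false) (hj : P i j = true) (hk : P i k = false) (hh : (c i).halted = false)
    (hri : (gr S c i).wanders = true) {g u : Bool} (hrj : gr S c j = .explore g u) :
    gr S (swapped S x P c) i =
      if gr S c i = .walk g true ∧ u = true ∧ (gp S c j).isSome = true then .finished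
      else .walk (!g) (gp S c j).isSome := by
  rw [swapped_one hij hik hjk hi hj hk hh, view_eq, hrj,
    Role.encounter_of_wanders (by simpa using hri)]
  have : (gr S c i).turned (S.chir i) = .walk (turn (S.chir i) g) true ↔
      gr S c i = .walk g true := by
    constructor
    · intro h
      have := congrArg (Role.turned (S.chir i)) h
      simpa using this
    · intro h; rw [h]; rfl
  simp only [Role.turned_explore, Role.join, Option.isSome_map, this]
  split
  · rfl
  · simp

/-- A walking robot that meets two explorers. -/
theorem swapped_walker_two {i j k : Fin 3} (hij : i ≠ j) (hik : i ≠ k) (hjk : j ≠ k)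
    (hi : P i i = false) (hj : P i j = true) (hk : P i k = true) (hh : (c i).halted = false)
    (hri : (gr S c i).wanders = true) {g u : Bool} (hrj : gr S c j = .explore g u) :
    ∃ d, gr S (swapped S x P c) i = .walk d false := by
  obtain ⟨l, hl, h⟩ := swapped_two (x := x) hij hik hjk hi hj hk hh
  rw [h, Role.encounter_of_wanders (by simpa using hri)]
  refine ⟨turn (S.chir i) true, ?_⟩
  rcases hl with rfl | rfl <;>
    simp [Role.join, view_eq, hrj, Role.explores]

/-- Walking robots that cross each other. -/
theorem swapped_crossing {i j k : Fin 3} (hij : i ≠ j) (hik : i ≠ k) (hjk : j ≠ k)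
    (hi : P i i = false) (hj : P i j = true) (hk : P i k = false) (hh : (c i).halted = false)
    {g f : Bool} (hri : gr S c i = .walk g f) (hrj : (gr S c j).wanders = true) :
    gr S (swapped S true P c) i = .explore g false := by
  rw [swapped_one hij hik hjk hi hj hk hh, view_eq, hri]
  revert hrj
  generalize gr S c j = r
  cases r <;> simp [Role.encounter, Role.join, Role.explores, Role.wanders]

end

section

variable {n : ℕ} {S : Setup n} {c : Config n (ℕ × Role)} {x : Bool} {P : Fin 3 → Fin 3 → Bool}

/-! ### The choice of roles -/

theorem Role.join_of_explores_none {r : Role} {p : Option Bool} {l : List Info}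
    (h : ∀ s ∈ l, s.2.1.explores = none) : r.join p false l = Role.found p l := by
  unfold Role.join
  split
  · simp [Role.explores] at h
  · rw [if_neg]
    · rfl
    · rw [List.any_eq_true]
      rintro ⟨s, hs, hs'⟩
      simp [h s hs] at hs'

/-- Robot `j` gets its role before robot `i` when they come together. -/
def before (S : Setup n) (c : Config n (ℕ × Role)) (j i : Fin 3) : Bool :=
  ((gp S c j).isSome && (gp S c i).isNone) ||
    (((gp S c j).isSome == (gp S c i).isSome) && decide ((c j).mem.1 < (c i).mem.1))

theorem precedes_view (i j : Fin 3) : precedes (c i).port (view S c i j) = before S c j i := by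
  simp [precedes, view_eq, before, port_eq S c]

/-- The global direction that robot `i` takes if it gets its role first. -/
def lead (S : Setup n) (c : Config n (ℕ × Role)) (i : Fin 3) : Bool :=
  turn (S.chir i) ((c i).port.getD true)

/-- The default in `Role.found` is explained here. A leader that is not waiting takes its own
"right", and the orientation bit is exactly the name that the observer gives to that port. -/
theorem view_lead (i j : Fin 3) :
    (view S c i j).2.2.1.getD (view S c i j).2.2.2 = turn (S.chir i) (lead S c j) := by
  rw [view_eq, lead, gp]
  cases h : (c j).port
  · cases S.chir i <;> cases S.chir j <;> rfl
  · simp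

theorem swapped_found {i j k : Fin 3} (hij : i ≠ j) (hik : i ≠ k) (hjk : j ≠ k)
    (hi : P i i = false) (hj : P i j = true) (hh : (c i).halted = false)
    (hr : ∀ l, (gr S c l).wanders = true) :
    ∃ l : List Info, (P i k = false ∧ l = [view S c i j] ∨
      P i k = true ∧ (l = [view S c i j, view S c i k] ∨ l = [view S c i k, view S c i j])) ∧
      gr S (swapped S false P c) i = (Role.found (c i).port l).turned (S.chir i) := by
  have hw : ∀ l, ((gr S c i).turned (S.chir i)).encounter ((gp S c i).map (turn (S.chir i)))
      false l = ((gr S c i).turned (S.chir i)).join (c i).port false l := fun l => by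
    rw [Role.encounter_of_wanders (by simpa using hr i), port_eq S c]
  have hv : ∀ l, (view S c i l).2.1.explores = none := fun l => by
    simp [view_eq, Role.explores_of_wanders (hr l)]
  cases hk : P i k
  · refine ⟨_, Or.inl ⟨rfl, rfl⟩, ?_⟩
    rw [swapped_one hij hik hjk hi hj hk hh, hw, Role.join_of_explores_none (by simp [hv])]
  · obtain ⟨l, hl, h⟩ := swapped_two (x := false) hij hik hjk hi hj hk hh
    refine ⟨l, Or.inr ⟨rfl, hl⟩, ?_⟩
    rw [h, hw, Role.join_of_explores_none]
    rcases hl with rfl | rfl <;> simp [hv]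

/-- The number of met robots that precede a robot decides its role: with none it leads, with one it
explores in the opposite direction, with two it walks. The next two lemmas are the other cases. -/
theorem swapped_first {i j k : Fin 3} (hij : i ≠ j) (hik : i ≠ k) (hjk : j ≠ k)
    (hi : P i i = false) (hj : P i j = true) (hh : (c i).halted = false)
    (hr : ∀ l, (gr S c l).wanders = true) (hbj : before S c j i = false)
    (hbk : P i k = true → before S c k i = false) :
    gr S (swapped S false P c) i = .explore (lead S c i) false := by
  obtain ⟨l, hl, h⟩ := swapped_found hij hik hjk hi hj hh hr
  rw [h]
  rcases hl with ⟨hk, rfl⟩ | ⟨hk, rfl | rfl⟩ <;>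
    simp [Role.found, precedes_view, hbj, hk, hbk, lead]

theorem swapped_second {i j k : Fin 3} (hij : i ≠ j) (hik : i ≠ k) (hjk : j ≠ k)
    (hi : P i i = false) (hj : P i j = true) (hh : (c i).halted = false)
    (hr : ∀ l, (gr S c l).wanders = true) (hbj : before S c j i = true)
    (hbk : P i k = true → before S c k i = false) :
    gr S (swapped S false P c) i = .explore (!lead S c j) false := by
  obtain ⟨l, hl, h⟩ := swapped_found hij hik hjk hi hj hh hr
  rw [h]
  rcases hl with ⟨hk, rfl⟩ | ⟨hk, rfl | rfl⟩ <;>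
    simp [Role.found, precedes_view, hbj, hk, hbk, view_lead]

theorem swapped_third {i j k : Fin 3} (hij : i ≠ j) (hik : i ≠ k) (hjk : j ≠ k)
    (hi : P i i = false) (hj : P i j = true) (hk : P i k = true) (hh : (c i).halted = false)
    (hr : ∀ l, (gr S c l).wanders = true) (hbj : before S c j i = true)
    (hbk : before S c k i = true) :
    ∃ d, gr S (swapped S false P c) i = .walk d false := by
  obtain ⟨l, hl, h⟩ := swapped_found hij hik hjk hi hj hh hr
  refine ⟨turn (S.chir i) true, ?_⟩
  rw [h]
  rcases hl with ⟨hk', rfl⟩ | ⟨-, rfl | rfl⟩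
  · simp [hk] at hk'
  all_goals simp [Role.found, precedes_view, hbj, hbk]

/-! ### Local computations -/

theorem mem_sightings {i : Fin 3} {P : Fin 3 → Bool} {s : Sighting (ℕ × Role)} :
    s ∈ sightings S c i P ↔ ∃ j, P j = true ∧ sight S c i j = s := by
  simp only [sightings, List.mem_map]
  constructor
  · rintro ⟨j, hj, rfl⟩
    exact ⟨j, by simpa using (List.perm_insertionSort _ _).mem_iff.1 hj, rfl⟩
  · rintro ⟨j, hj, rfl⟩
    exact ⟨j, (List.perm_insertionSort _ _).mem_iff.2 (by simpa using hj), rfl⟩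

theorem length_sightings_le {i : Fin 3} {P : Fin 3 → Bool} (h : P i = false) :
    (sightings S c i P).length ≤ 2 := by
  obtain ⟨j, k, hij, hik, hjk⟩ : ∃ j k : Fin 3, i ≠ j ∧ i ≠ k ∧ j ≠ k := by
    clear h; revert i; decide
  rw [(sightings_perm hij hik hjk i P).length_eq, List.length_map, List.filter_cons_of_neg (by simp [h])]
  exact List.length_filter_le _ _

theorem infos_toList (id : ℕ) {l : List (Sighting (ℕ × Role))} (h : l.length ≤ 2) :
    (infos id l).1.toList ++ (infos id l).2.toList = l.map (info id) := by
  match l, h with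
  | [], _ => rfl
  | [a], _ => rfl
  | [a, b], _ => rfl
  | a :: b :: d :: l, h => simp at h

/-- The configuration after the local computations. -/
noncomputable abbrev computed (S : Setup n) (ω : Coins) (W : Finset (Fin 3))
    (c : Config n (ℕ × Role)) : Config n (ℕ × Role) := compute ringAlgorithm S ω W c

variable {ω : Coins} {W : Finset (Fin 3)}

theorem computed_asleep {i : Fin 3} (h : i ∉ W) : computed S ω W c i = c i := by
  simp [computed, compute, h]

@[simp] theorem computed_pos (i : Fin 3) : (computed S ω W c i).pos = (c i).pos := by
  simp only [computed, compute]
  split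
  · split <;> rfl
  · rfl

@[simp] theorem computed_id (i : Fin 3) : (computed S ω W c i).mem.1 = (c i).mem.1 := by
  simp only [computed, compute]
  split
  · split <;> rfl
  · rfl

theorem computed_halted_of_halted {i : Fin 3} (h : (c i).halted = true) :
    (computed S ω W c i).halted = true := by
  simp [computed, compute, h]

/-- What an awake robot learns from the robots at its node. -/
def seen (S : Setup n) (c : Config n (ℕ × Role)) (i : Fin 3) : List Info :=
  (sightings S c i (fun j => decide (j ≠ i) && decide ((c j).pos = (c i).pos))).map
    (info (c i).mem.1)

theorem any_seen {i : Fin 3} {q : Info → Bool} : (seen S c i).any q = true ↔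
    ∃ j, j ≠ i ∧ (c j).pos = (c i).pos ∧ q (view S c i j) = true := by
  simp only [seen, List.any_map, List.any_eq_true, mem_sightings]
  constructor
  · rintro ⟨s, ⟨j, hj, rfl⟩, hs⟩
    simp only [Bool.and_eq_true, decide_eq_true_eq] at hj
    exact ⟨j, hj.1, hj.2, hs⟩
  · rintro ⟨j, h1, h2, h3⟩
    exact ⟨_, ⟨j, by simp [h1, h2], rfl⟩, h3⟩

theorem computed_awake {i : Fin 3} (hW : i ∈ W) (hh : (c i).halted = false) {r : Role}
    (hr : (c i).mem.2.next (c i).port (seen S c i) (ω (i, (c i).coins)) = r) :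
    computed S ω W c i = match r.action with
      | none => ⟨(c i).pos, none, ((c i).mem.1, r), true, (c i).coins + 1⟩
      | some p => ⟨(c i).pos, p, ((c i).mem.1, r), false, (c i).coins + 1⟩ := by
  subst hr
  simp only [computed, compute, hW, hh, and_self, if_true, ringAct]
  rw [infos_toList _ (length_sightings_le (by simp))]
  rfl

theorem computed_finished {i : Fin 3} (hr : gr S c i = .finished) :
    gr S (computed S ω W c) i = .finished ∧ (i ∈ W → (computed S ω W c i).halted = true) := by
  by_cases hW : i ∈ W
  · cases hh : (c i).halted
    · have hm : (c i).mem.2 = .finished := by rw [role_eq S c, hr]; rfl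
      have h := computed_awake (S := S) (ω := ω) hW hh (r := .finished) (by rw [hm]; rfl)
      simp [gr, h, Role.action]
    · have h : computed S ω W c i = c i := by simp [computed, compute, hh]
      rw [gr_congr h, h]
      exact ⟨hr, fun _ => hh⟩
  · exact ⟨by rw [gr_congr (computed_asleep hW), hr], fun h => (hW h).elim⟩

theorem computed_explorer {i : Fin 3} (hW : i ∈ W) (hh : (c i).halted = false) {g u : Bool}
    (hr : gr S c i = .explore g u) :
    gr S (computed S ω W c) i = .explore g (u && (gp S c i).isSome) ∧
      gp S (computed S ω W c) i = some g ∧ (computed S ω W c i).halted = false := by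
  have hm : (c i).mem.2 = .explore (turn (S.chir i) g) u := by rw [role_eq S c, hr]; rfl
  have h := computed_awake (S := S) (ω := ω) hW hh rfl
  rw [hm] at h
  simp [gr, gp, h, Role.action, Role.next]

theorem computed_of_proceed {i : Fin 3} (hW : i ∈ W) (hh : (c i).halted = false) {d f : Bool}
    (hm : (c i).mem.2.next (c i).port (seen S c i) (ω (i, (c i).coins)) =
      Role.proceed (seen S c i) (turn (S.chir i) d) f) {d' f' : Bool}
    (hd : ((∀ j, j ≠ i → (c j).pos = (c i).pos → (gr S c j).explores ≠ some d) ∧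
        d' = d ∧ f' = f) ∨
      ((∃ j, j ≠ i ∧ (c j).pos = (c i).pos ∧ (gr S c j).explores = some d) ∧
        d' = !d ∧ f' = false)) :
    gr S (computed S ω W c) i = .walk d' f' ∧ gp S (computed S ω W c) i = some d' ∧
      (computed S ω W c i).halted = false := by
  have hq : ∀ j, ((view S c i j).2.1.explores == some (turn (S.chir i) d)) = true ↔
      (gr S c j).explores = some d := fun j => by
    rw [view_eq]
    cases h : (gr S c j).explores <;> simp [h]
  have hp : Role.proceed (seen S c i) (turn (S.chir i) d) f = .walk (turn (S.chir i) d') f' := by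
    rw [Role.proceed]
    rcases hd with ⟨h, rfl, rfl⟩ | ⟨h, rfl, rfl⟩
    · rw [if_neg]
      rw [any_seen]
      rintro ⟨j, h1, h2, h3⟩
      exact h j h1 h2 ((hq j).1 h3)
    · rw [if_pos, turn_not]
      rw [any_seen]
      obtain ⟨j, h1, h2, h3⟩ := h
      exact ⟨j, h1, h2, (hq j).2 h3⟩
  have h := computed_awake (S := S) (ω := ω) hW hh (hm.trans hp)
  simp [gr, gp, h, Role.action]

/-- Robot `i` is about to walk in direction `d` with flag `f`. -/
def Heads (S : Setup n) (ω : Coins) (c : Config n (ℕ × Role)) (i : Fin 3) (d f : Bool) : Prop :=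
  gr S c i = .walk d f ∨ gr S c i = .fresh ∧ turn (S.chir i) (ω (i, (c i).coins)) = d ∧ f = false

theorem computed_walker {i : Fin 3} (hW : i ∈ W) (hh : (c i).halted = false) {d f : Bool}
    (hr : Heads S ω c i d f) {d' f' : Bool}
    (hd : ((∀ j, j ≠ i → (c j).pos = (c i).pos → (gr S c j).explores ≠ some d) ∧
        d' = d ∧ f' = f) ∨
      ((∃ j, j ≠ i ∧ (c j).pos = (c i).pos ∧ (gr S c j).explores = some d) ∧
        d' = !d ∧ f' = false)) :
    gr S (computed S ω W c) i = .walk d' f' ∧ gp S (computed S ω W c) i = some d' ∧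
      (computed S ω W c i).halted = false := by
  refine computed_of_proceed hW hh ?_ hd
  rcases hr with hr | ⟨hr, rfl, rfl⟩ <;> rw [role_eq S c, hr]
  · rfl
  · simp [Role.next]

/-! ### Moves -/

variable {cut : Option (ZMod n)}

/-- The global direction in which robot `i` moves, if it does. -/
def goes (S : Setup n) (cut : Option (ZMod n)) (c : Config n (ℕ × Role)) (i : Fin 3) :
    Option Bool :=
  (gp S c i).bind fun g => if cut = some (edgeFrom (c i).pos g) then none else some g

theorem traversal_eq (i : Fin 3) : traversal S cut c i =
    (goes S cut c i).map fun g => (edgeFrom (c i).pos g, g) := by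
  simp only [traversal, goes, gp]
  cases (c i).port
  · rfl
  · simp only [Option.bind_some, Option.map_some]
    split <;> rfl

theorem goes_eq_some {i : Fin 3} {g : Bool} : goes S cut c i = some g ↔
    gp S c i = some g ∧ cut ≠ some (edgeFrom (c i).pos g) := by
  simp only [goes]
  cases gp S c i
  · simp
  · simp only [Option.bind_some]
    split <;> simp <;> aesop

theorem goes_eq_none {i : Fin 3} {g : Bool} (h : goes S cut c i = none) (hg : gp S c i = some g) :
    cut = some (edgeFrom (c i).pos g) := by
  by_contra hc
  have := goes_eq_some.2 ⟨hg, hc⟩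
  simp [h] at this

theorem relocate_stay {i : Fin 3} (h : goes S cut c i = none) : relocate S cut c i = c i := by
  simp [relocate, traversal_eq, h]

theorem relocate_go {i : Fin 3} {g : Bool} (h : goes S cut c i = some g) :
    relocate S cut c i = { c i with pos := neighbour (c i).pos g, port := none } := by
  simp [relocate, traversal_eq, h]

theorem relocate_gr (i : Fin 3) : gr S (relocate S cut c) i = gr S c i := by
  cases h : goes S cut c i <;> simp [gr, relocate_stay, relocate_go, h]

theorem relocate_id (i : Fin 3) : (relocate S cut c i).mem.1 = (c i).mem.1 := by
  cases h : goes S cut c i <;> simp [relocate_stay, relocate_go, h]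

theorem relocate_halted (i : Fin 3) : (relocate S cut c i).halted = (c i).halted := by
  cases h : goes S cut c i <;> simp [relocate_stay, relocate_go, h]

theorem relocate_coins (i : Fin 3) : (relocate S cut c i).coins = (c i).coins := by
  cases h : goes S cut c i <;> simp [relocate_stay, relocate_go, h]

theorem relocate_gp_of_go {i : Fin 3} {g : Bool} (h : goes S cut c i = some g) :
    gp S (relocate S cut c) i = none := by
  simp [gp, relocate_go h]

/-- A move clears the port, so a port still occupied after the moves certifies that its edge was
missing in this round. -/
theorem goes_of_relocate_gp {i : Fin 3} (h : gp S (relocate S cut c) i ≠ none) :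
    goes S cut c i = none ∧ gp S c i = gp S (relocate S cut c) i := by
  cases hg : goes S cut c i
  · exact ⟨rfl, (gp_congr (relocate_stay hg)).symm⟩
  · exact (h (relocate_gp_of_go hg)).elim

theorem crossed_eq_true {i j : Fin 3} : crossed S cut c i j = true ↔
    ∃ g, goes S cut c i = some g ∧ goes S cut c j = some (!g) ∧
      edgeFrom (c i).pos g = edgeFrom (c j).pos (!g) := by
  simp only [crossed, traversal_eq]
  cases goes S cut c i <;> cases goes S cut c j <;> simp
  rename_i a b
  cases a <;> cases b <;> simp

theorem joined_eq_true {i j : Fin 3} : joined S cut c i j = true ↔ i ≠ j ∧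
    (relocate S cut c i).pos = (relocate S cut c j).pos ∧
    (goes S cut c i ≠ none ∨ goes S cut c j ≠ none) := by
  simp [joined, traversal_eq, Option.isSome_iff_ne_none, and_assoc]

theorem joined_comm (i j : Fin 3) : joined S cut c i j = joined S cut c j i := by
  rw [Bool.eq_iff_iff, joined_eq_true, joined_eq_true]
  tauto

theorem crossed_comm (i j : Fin 3) : crossed S cut c i j = crossed S cut c j i := by
  rw [Bool.eq_iff_iff, crossed_eq_true, crossed_eq_true]
  constructor <;> rintro ⟨g, h1, h2, h3⟩ <;> exact ⟨!g, by simpa using h2, by simpa using h1, by simpa using h3.symm⟩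

theorem joined_self (i : Fin 3) : joined S cut c i i = false := by
  simp [joined]

theorem crossed_self (i : Fin 3) : crossed S cut c i i = false := by
  rw [← Bool.not_eq_true, crossed_eq_true]
  rintro ⟨g, h1, h2, -⟩
  rw [h1] at h2
  simp at h2

/-- The configuration after the moves and the meetings. -/
noncomputable abbrev transported (S : Setup n) (cut : Option (ZMod n))
    (c : Config n (ℕ × Role)) : Config n (ℕ × Role) := transport ringAlgorithm S cut c

theorem transported_eq : transported S cut c =
    swapped S false (joined S cut c) (swapped S true (crossed S cut c) (relocate S cut c)) := rfl

end

section

variable {n : ℕ} {S : Setup n} {c : Config n (ℕ × Role)} {x : Bool} {P : Fin 3 → Fin 3 → Bool}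
  {ω : Coins} {W : Finset (Fin 3)} {cut : Option (ZMod n)} {V V' : Set (ZMod n)}

/-! ### Two explorers and a walker -/

/-- Both explorers wait on their ports. -/
def Blocked (S : Setup n) (c : Config n (ℕ × Role)) (e : Bool → Fin 3) : Prop :=
  ∀ g, gp S c (e g) ≠ none

/-- The robots `e true` and `e false` explore the ring in the global directions `true` and `false`;
the `r + 1` nodes from `e false` to `e true` belong to the set `V` of visited nodes. The robot `w`
walks between the explorers. -/
structure Duo (S : Setup n) (V : Set (ZMod n)) (c : Config n (ℕ × Role)) (e : Bool → Fin 3)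
    (w : Fin 3) (r : ℕ) : Prop where
  ne : ∀ g, e g ≠ e (!g)
  ne_third : ∀ g, e g ≠ w
  running : ∀ i, (c i).halted = false
  role : ∀ g, ∃ u, gr S c (e g) = .explore g u
  third : (gr S c w).wanders = true
  port : ∀ g, gp S c (e g) = none ∨ gp S c (e g) = some g
  sep : (c (e true)).pos = (c (e false)).pos + r
  visited : ∀ k : ℕ, k ≤ r → (c (e false)).pos + k ∈ V
  -- The hypotheses describe a walker returning from a waiting explorer towards one that has been
  -- waiting since their last meeting. Demanding an occupied port matters: an explorer transported
  -- in its sleep keeps its flag until it is activated.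
  confirmed : ∀ g, gr S c w = .walk g true → gr S c (e g) = .explore g true →
    gp S c (e g) ≠ none → r + 1 = n ∧ Blocked S c e

theorem eq_third {e : Bool → Fin 3} {w : Fin 3} (h1 : ∀ g, e g ≠ e (!g)) (h2 : ∀ g, e g ≠ w)
    (i : Fin 3) : (∃ g, i = e g) ∨ i = w := by
  have ht := h1 true
  have hw := h2 true
  have hw' := h2 false
  simp only [Bool.not_true] at ht
  simp only [Bool.exists_bool]
  revert ht hw hw'
  generalize e true = a
  generalize e false = b
  clear h1 h2
  revert a b w i
  decide

theorem exists_heads {i : Fin 3} (h : (gr S c i).wanders = true) :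
    ∃ d f, Heads S ω c i d f ∧ (gr S c i = .walk d f ∨ f = false) := by
  cases hr : gr S c i
  · exact ⟨_, false, Or.inr ⟨hr, rfl, rfl⟩, Or.inr rfl⟩
  · exact ⟨_, _, Or.inl hr, Or.inl rfl⟩
  all_goals simp [hr, Role.wanders] at h

/-- The last clause serves `Duo.confirmed`: a local computation never creates a set flag, as both a
first choice of direction and a turn clear it. -/
theorem computed_wanders {i : Fin 3} (hW : i ∈ W) (hh : (c i).halted = false)
    (h : (gr S c i).wanders = true) :
    ∃ d f, gr S (computed S ω W c) i = .walk d f ∧ gp S (computed S ω W c) i = some d ∧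
      (computed S ω W c i).halted = false ∧ (f = true → gr S c i = .walk d true) := by
  obtain ⟨d, f, hd, hf⟩ := exists_heads (ω := ω) h
  by_cases hs : ∃ j, j ≠ i ∧ (c j).pos = (c i).pos ∧ (gr S c j).explores = some d
  · obtain ⟨h1, h2, h3⟩ := computed_walker hW hh hd (Or.inr ⟨hs, rfl, rfl⟩)
    exact ⟨_, _, h1, h2, h3, by simp⟩
  · push Not at hs
    obtain ⟨h1, h2, h3⟩ := computed_walker hW hh hd (Or.inl ⟨hs, rfl, rfl⟩)
    refine ⟨_, _, h1, h2, h3, ?_⟩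
    rintro rfl
    simpa using hf

/-- The number of moves of robot `i` in a round. -/
def gain (S : Setup n) (cut : Option (ZMod n)) (c : Config n (ℕ × Role)) (i : Fin 3) : ℕ :=
  if goes S cut c i = none then 0 else 1

theorem gain_le (i : Fin 3) : gain S cut c i ≤ 1 := by
  unfold gain; split <;> simp

theorem gain_of_stay {i : Fin 3} (h : goes S cut c i = none) : gain S cut c i = 0 := by
  simp [gain, h]

theorem gain_of_go {i : Fin 3} (h : goes S cut c i ≠ none) : gain S cut c i = 1 := by
  simp [gain, h]

/-- Some robot knows that the ring is explored. -/
def Known (S : Setup n) (V : Set (ZMod n)) (c : Config n (ℕ × Role)) : Prop :=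
  V = Set.univ ∧ ∃ i, gr S c i = .finished

/-! ### Invariance of the explorer pair under computations, moves and meetings. -/

namespace Duo

variable {e : Bool → Fin 3} {w : Fin 3} {r : ℕ}

theorem cover [NeZero n] (h : Duo S V c e w r) (hr : n ≤ r + 1) : V = Set.univ := by
  refine Set.eq_univ_of_forall fun v => ?_
  have hlt := ZMod.val_lt (v - (c (e false)).pos)
  have := h.visited (v - (c (e false)).pos).val (by omega)
  simpa using this

theorem explorer_computed (h : Duo S V c e w r) (g : Bool) :
    (computed S ω W c (e g)).halted = false ∧
    (e g ∈ W → gp S (computed S ω W c) (e g) = some g) ∧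
    (gp S c (e g) ≠ none → gp S (computed S ω W c) (e g) = some g) ∧
    (gp S (computed S ω W c) (e g) = none ∨ gp S (computed S ω W c) (e g) = some g) ∧
    ∃ u u', gr S c (e g) = .explore g u ∧ gr S (computed S ω W c) (e g) = .explore g u' ∧
      (u' = true → u = true ∧ (e g ∈ W → gp S c (e g) ≠ none)) ∧
      (gp S c (e g) ≠ none → u' = u) := by
  obtain ⟨u, hu⟩ := h.role g
  by_cases hW : e g ∈ W
  · obtain ⟨h1, h2, h3⟩ := computed_explorer (ω := ω) hW (h.running _) hu
    refine ⟨h3, fun _ => h2, fun _ => h2, Or.inr h2, u, _, hu, h1, ?_, ?_⟩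
    · intro hu'
      simp only [Bool.and_eq_true] at hu'
      exact ⟨hu'.1, fun _ => by simpa [Option.isSome_iff_ne_none] using hu'.2⟩
    · intro hp
      simp [Option.isSome_iff_ne_none.2 hp]
  · have hc := computed_asleep (S := S) (c := c) (ω := ω) hW
    rw [gp_congr hc, gr_congr hc, hc]
    refine ⟨h.running _, fun h => (hW h).elim, fun hp => (h.port g).resolve_left hp, h.port g, u, u,
      hu, hu, fun h => ⟨h, fun h => (hW h).elim⟩, fun _ => rfl⟩

theorem blocked_computed (h : Duo S V c e w r) (hb : Blocked S c e) :
    Blocked S (computed S ω W c) e := fun g => by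
  rw [(h.explorer_computed g).2.2.1 (hb g)]
  simp

theorem computed (h : Duo S V c e w r) : Duo S V (computed S ω W c) e w r where
  ne := h.ne
  ne_third := h.ne_third
  running i := by
    rcases eq_third h.ne h.ne_third i with ⟨g, rfl⟩ | rfl
    · exact (h.explorer_computed g).1
    · by_cases hW : i ∈ W
      · obtain ⟨d, f, -, -, h3, -⟩ := computed_wanders (ω := ω) hW (h.running i) h.third
        exact h3
      · rw [computed_asleep hW, h.running]
  role g := by
    obtain ⟨u, u', -, hu', -⟩ := (h.explorer_computed (ω := ω) (W := W) g).2.2.2.2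
    exact ⟨u', hu'⟩
  third := by
    by_cases hW : w ∈ W
    · obtain ⟨d, f, h1, -⟩ := computed_wanders (ω := ω) hW (h.running w) h.third
      rw [h1]; rfl
    · rw [gr_congr (computed_asleep hW), h.third]
  port g := (h.explorer_computed g).2.2.2.1
  sep := by simpa using h.sep
  visited := by simpa using h.visited
  confirmed g hw hg hp := by
    obtain ⟨u, u', hu, hu', hi, -⟩ := (h.explorer_computed (ω := ω) (W := W) g).2.2.2.2
    rw [hu'] at hg
    obtain ⟨rfl, hi'⟩ := hi (by simpa using hg)
    have hw' : gr S c w = .walk g true := by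
      by_cases hW : w ∈ W
      · obtain ⟨d, f, h1, -, -, h2⟩ := computed_wanders (ω := ω) hW (h.running w) h.third
        rw [h1] at hw
        obtain ⟨rfl, rfl⟩ : d = g ∧ f = true := by simpa using hw
        exact h2 rfl
      · rwa [gr_congr (computed_asleep hW)] at hw
    have hp' : gp S c (e g) ≠ none := by
      by_cases hW : e g ∈ W
      · exact hi' hW
      · rwa [gp_congr (computed_asleep hW)] at hp
    obtain ⟨h1, h2⟩ := h.confirmed g hw' hu hp'
    exact ⟨h1, h.blocked_computed h2⟩

theorem goes_eq (h : Duo S V c e w r) (g : Bool) :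
    goes S cut c (e g) = none ∨ goes S cut c (e g) = some g := by
  cases hg : goes S cut c (e g) with
  | none => exact Or.inl rfl
  | some g' =>
    have := (goes_eq_some.1 hg).1
    rcases h.port g with h1 | h1 <;> simp_all

/-- The edges ahead of the explorers coincide exactly when the complement of the arc is a single
edge. The bound `r < n` rules out higher multiples of `n`. -/
theorem edge_eq_iff [NeZero n] (h : Duo S V c e w r) (hr : r < n) :
    edgeFrom (c (e true)).pos true = edgeFrom (c (e false)).pos false ↔ r + 1 = n := by
  rw [h.sep]
  simp only [edgeFrom, if_true, Bool.false_eq_true, if_false]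
  have : (c (e false)).pos + (r : ZMod n) = (c (e false)).pos - 1 ↔
      ((r + 1 : ℕ) : ZMod n) = 0 := by
    push_cast
    constructor
    · intro h; linear_combination h
    · intro h; linear_combination h
  rw [this, ZMod.natCast_eq_zero_iff]
  constructor
  · intro hd
    have := Nat.le_of_dvd (by omega) hd
    omega
  · rintro h; rw [h]

theorem edge_eq_not [NeZero n] (h : Duo S V c e w r) (hr : r + 1 = n) (g : Bool) :
    edgeFrom (c (e g)).pos g = edgeFrom (c (e (!g))).pos (!g) := by
  have := (h.edge_eq_iff (by omega)).2 hr
  cases g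
  · exact this.symm
  · exact this

/-- Both explorers waiting after the moves means that both edges ahead are missing; at most one edge
is, so they are the same edge. -/
theorem blocked_of_relocate [NeZero n] (h : Duo S V c e w r) (hr : r < n)
    (hb : Blocked S (relocate S cut c) e) : r + 1 = n := by
  have hc : ∀ g, cut = some (edgeFrom (c (e g)).pos g) := fun g => by
    obtain ⟨h1, h2⟩ := goes_of_relocate_gp (hb g)
    exact goes_eq_none h1 ((h.port g).resolve_left (by rw [h2]; exact hb g))
  have := (hc true).symm.trans (hc false)
  exact (h.edge_eq_iff hr).1 (by simpa using this)

theorem pos_relocate_true (h : Duo S V c e w r) :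
    (relocate S cut c (e true)).pos = (c (e true)).pos + (gain S cut c (e true) : ℕ) := by
  rcases h.goes_eq (cut := cut) true with h1 | h1
  · simp [relocate_stay h1, gain, h1]
  · simp [relocate_go h1, gain, h1, neighbour]

theorem pos_relocate_false (h : Duo S V c e w r) :
    (relocate S cut c (e false)).pos = (c (e false)).pos - (gain S cut c (e false) : ℕ) := by
  rcases h.goes_eq (cut := cut) false with h1 | h1
  · simp [relocate_stay h1, gain, h1]
  · simp [relocate_go h1, gain, h1, neighbour]

theorem relocate [NeZero n] (h : Duo S V c e w r) (hV : V ⊆ V')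
    (hp : ∀ i, (relocate S cut c i).pos ∈ V') :
    Duo S V' (relocate S cut c) e w (r + gain S cut c (e true) + gain S cut c (e false)) where
  ne := h.ne
  ne_third := h.ne_third
  running i := by rw [relocate_halted, h.running]
  role g := by rw [relocate_gr]; exact h.role g
  third := by rw [relocate_gr]; exact h.third
  port g := by
    cases hg : gp S (DynamicRing.relocate S cut c) (e g) with
    | none => exact Or.inl rfl
    | some d =>
      rw [← hg, ← (goes_of_relocate_gp (by rw [hg]; simp)).2]
      exact h.port g
  sep := by
    rw [h.pos_relocate_true, h.pos_relocate_false, h.sep]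
    push_cast
    ring
  visited k hk := by
    rcases Nat.eq_zero_or_pos k with rfl | hk0
    · simpa using hp (e false)
    have hpt := hp (e true)
    rw [h.pos_relocate_true, h.sep] at hpt
    rw [h.pos_relocate_false]
    have hgt := gain_le (S := S) (cut := cut) (c := c) (e true)
    have hgf := gain_le (S := S) (cut := cut) (c := c) (e false)
    -- Nodes are counted from the new position of `e false`. Beyond the old arc and the new first
    -- node, only the new position of `e true` remains.
    rcases Nat.lt_or_ge r (k - gain S cut c (e false)) with hlt | hge
    · have hk' : k = r + gain S cut c (e true) + gain S cut c (e false) := by omega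
      rw [hk']
      convert hpt using 1
      push_cast
      ring
    · have := hV (h.visited _ hge)
      rw [Nat.cast_sub (by omega)] at this
      convert this using 1
      ring
  confirmed g hw hg hgp := by
    rw [relocate_gr] at hw hg
    obtain ⟨h1, h2⟩ := goes_of_relocate_gp hgp
    obtain ⟨h3, h4⟩ := h.confirmed g hw hg (by rwa [h2])
    -- Both explorers face the same edge, so the one that is still waiting proves that the other
    -- cannot move either.
    have hstay : ∀ d, goes S cut c (e d) = none := by
      have hcut := goes_eq_none h1 ((h.port g).resolve_left (by rwa [h2]))
      intro d
      rcases h.goes_eq (cut := cut) d with hd | hd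
      · exact hd
      · refine ((goes_eq_some.1 hd).2 ?_).elim
        rw [hcut]
        rcases eq_or_ne d g with rfl | hne
        · rfl
        · have : d = !g := Bool.eq_not.2 hne
          rw [this, h.edge_eq_not h3]
    refine ⟨by simp [gain, hstay, h3], fun d => ?_⟩
    rw [gp_congr (relocate_stay (hstay d))]
    exact h4 d

theorem wanders_explores (h : Duo S V c e w r) : (gr S c w).explores = none :=
  Role.explores_of_wanders h.third

/-- A swap of data in which the explorers do not meet each other. -/
theorem swapped (h : Duo S V c e w r) (hb : Blocked S c e → r + 1 = n)
    (hP : ∀ i, P i i = false) (hs : ∀ i j, P i j = P j i)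
    (he : P (e true) (e false) = false) :
    Duo S V (swapped S x P c) e w r ∨
      r + 1 = n ∧ gr S (DynamicRing.swapped S x P c) w = .finished := by
  have he' : ∀ g, P (e g) (e (!g)) = false := fun g => by
    cases g
    · rw [hs]; exact he
    · exact he
  have hmet : ∀ g, P (e g) w = true →
      gr S (DynamicRing.swapped S x P c) (e g) = .explore g (gp S c (e g)).isSome := fun g hg => by
    obtain ⟨u, hu⟩ := h.role g
    exact swapped_explorer (h.ne_third g) (h.ne g) (h.ne_third _).symm (hP _) hg (he' g)
      (h.running _) hu h.wanders_explores
  have hunmet : ∀ g, P (e g) w = false → DynamicRing.swapped S x P c (e g) = c (e g) := by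
    intro g hg
    refine swapped_alone fun j => ?_
    rcases eq_third h.ne h.ne_third j with ⟨d, rfl⟩ | rfl
    · rcases eq_or_ne d g with rfl | hne
      · exact hP _
      · have : d = !g := Bool.eq_not.2 hne
        rw [this, he']
    · exact hg
  have hblock : Blocked S (DynamicRing.swapped S x P c) e ↔ Blocked S c e := by simp [Blocked]
  have main : (gr S (DynamicRing.swapped S x P c) w).wanders = true →
      (∀ g, gr S (DynamicRing.swapped S x P c) w = .walk g true →
        gr S (DynamicRing.swapped S x P c) (e g) = .explore g true → gp S c (e g) ≠ none →
        r + 1 = n ∧ Blocked S c e) →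
      Duo S V (DynamicRing.swapped S x P c) e w r := fun h1 h2 =>
    { ne := h.ne
      ne_third := h.ne_third
      running := fun i => by rw [swapped_halted, h.running]
      role := fun g => by
        cases hg : P (e g) w
        · rw [gr_congr (hunmet g hg)]; exact h.role g
        · exact ⟨_, hmet g hg⟩
      third := h1
      port := fun g => by rw [swapped_gp]; exact h.port g
      sep := by simpa using h.sep
      visited := by simpa using h.visited
      confirmed := fun g hw hg hp => by
        rw [swapped_gp] at hp
        rw [hblock]
        exact h2 g hw hg hp }
  by_cases hall : ∃ g, P w (e g) = true
  · obtain ⟨g, hg⟩ := hall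
    obtain ⟨u, hu⟩ := h.role g
    cases hg' : P w (e (!g))
    · have hw := swapped_walker (x := x) (h.ne_third g).symm (h.ne_third (!g)).symm (h.ne g)
        (hP w) hg hg' (h.running w) h.third hu
      split_ifs at hw with hc
      · right
        -- The condition under which the walker finishes is precisely the hypothesis of `confirmed`.
        obtain ⟨h1, rfl, h3⟩ := hc
        exact ⟨(h.confirmed g h1 hu (Option.isSome_iff_ne_none.1 h3)).1, hw⟩
      · left
        refine main (by rw [hw]; rfl) fun d' hd he hp => ?_
        rw [hw] at hd
        have hd' : (gp S c (e g)).isSome = true := (Role.walk.inj hd).2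
        -- The new flag of the walker says that explorer `g` waits; `hp` says the same of the
        -- explorer towards which the walker now heads.
        have hblk : Blocked S c e := fun d => by
          rcases eq_or_ne d g with rfl | hne
          · exact Option.isSome_iff_ne_none.1 hd'
          · rwa [Bool.eq_not.2 hne, (Role.walk.inj hd).1]
        exact ⟨hb hblk, hblk⟩
    · left
      obtain ⟨d, hw⟩ := swapped_walker_two (x := x) (h.ne_third g).symm (h.ne_third (!g)).symm
        (h.ne g) (hP w) hg hg' (h.running w) h.third hu
      exact main (by rw [hw]; rfl) (by simp [hw])
  · left
    have hno : ∀ g, P w (e g) = false := by simpa using hall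
    have hw : DynamicRing.swapped S x P c w = c w := by
      refine swapped_alone fun j => ?_
      rcases eq_third h.ne h.ne_third j with ⟨d, rfl⟩ | rfl
      · exact hno d
      · exact hP _
    refine main (by rw [gr_congr hw]; exact h.third) fun g hg hg' hp => ?_
    rw [gr_congr hw] at hg
    rw [gr_congr (hunmet g (by rw [hs, hno]))] at hg'
    exact h.confirmed g hg hg' hp

/-- As the arc grows by at most two per round, the explorers either meet at a node (new length `n`),
or cross on the last edge (old length `n - 1`), or the new arc is still shorter than `n`. In the
first two cases the ring is covered. -/
theorem transported [NeZero n] (h : Duo S V c e w r) (hr : r < n) (hV : V ⊆ V')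
    (hp : ∀ i, (DynamicRing.relocate S cut c i).pos ∈ V') :
    Known S V' (transported S cut c) ∨
    Duo S V' (DynamicRing.transported S cut c) e w
        (r + gain S cut c (e true) + gain S cut c (e false)) ∧
      r + gain S cut c (e true) + gain S cut c (e false) < n ∧
      (Blocked S (DynamicRing.transported S cut c) e →
        r + gain S cut c (e true) + gain S cut c (e false) + 1 = n) := by
  have h2 := h.relocate hV hp
  have hb2 : Blocked S (DynamicRing.relocate S cut c) e →
      r + gain S cut c (e true) + gain S cut c (e false) + 1 = n := fun hb => by
    rw [gain_of_stay (goes_of_relocate_gp (hb true)).1, gain_of_stay (goes_of_relocate_gp (hb false)).1]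
    exact h.blocked_of_relocate hr hb
  have hfin : ∀ {r'}, Duo S V' (DynamicRing.relocate S cut c) e w r' → n ≤ r' + 1 →
      (∃ i, gr S (DynamicRing.swapped S true (crossed S cut c) (DynamicRing.relocate S cut c)) i =
        .finished) → Known S V' (DynamicRing.transported S cut c) := by
    rintro r' h' hr' ⟨i, hi⟩
    exact ⟨h'.cover hr', i, by rw [transported_eq, swapped_finished hi]⟩
  obtain ⟨ut, hut⟩ := h2.role true
  obtain ⟨uf, huf⟩ := h2.role false
  cases hcr : crossed S cut c (e true) (e false)
  · rcases h2.swapped (x := true) hb2 crossed_self crossed_comm hcr with h3 | ⟨h3, h4⟩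
    · cases hj : joined S cut c (e true) (e false)
      · have hlt : r + gain S cut c (e true) + gain S cut c (e false) < n := by
          by_contra hge
          rw [← Bool.not_eq_true, joined_eq_true] at hj
          rw [← Bool.not_eq_true, crossed_eq_true] at hcr
          rcases h.goes_eq (cut := cut) true with ht | ht <;>
            rcases h.goes_eq (cut := cut) false with hf | hf
          · rw [gain_of_stay ht, gain_of_stay hf] at hge
            omega
          · rw [gain_of_stay ht, gain_of_go (by simp [hf])] at hge h2
            refine hj ⟨h.ne true, ?_, Or.inr (by simp [hf])⟩
            rw [h2.sep, (by omega : r + 0 + 1 = n)]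
            simp
          · rw [gain_of_stay hf, gain_of_go (by simp [ht])] at hge h2
            refine hj ⟨h.ne true, ?_, Or.inl (by simp [ht])⟩
            rw [h2.sep, (by omega : r + 1 + 0 = n)]
            simp
          · rw [gain_of_go (i := e true) (by simp [ht]), gain_of_go (i := e false) (by simp [hf])] at hge h2
            rcases Nat.lt_or_ge (r + 1) n with hlt | hge'
            · refine hj ⟨h.ne true, ?_, Or.inl (by simp [ht])⟩
              rw [h2.sep, (by omega : r + 1 + 1 = n)]
              simp
            · exact hcr ⟨true, ht, hf, (h.edge_eq_iff hr).2 (by omega)⟩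
        rcases h3.swapped (x := false) (P := joined S cut c) (by simpa [Blocked] using hb2)
          joined_self joined_comm hj with h4 | ⟨h4, h5⟩
        · exact Or.inr ⟨h4, hlt, by simpa [Blocked, transported_eq] using hb2⟩
        · exact Or.inl ⟨h2.cover (by omega), w, h5⟩
      · left
        have hj' := joined_eq_true.1 hj
        -- Equal positions make the new length a multiple of `n`. It is positive because one
        -- explorer has just arrived; this excludes the common starting node with `r = 0`.
        have hge : n ≤ r + gain S cut c (e true) + gain S cut c (e false) := by
          have h5 := hj'.2.1
          rw [h2.sep] at h5
          have h6 : ((r + gain S cut c (e true) + gain S cut c (e false) : ℕ) : ZMod n) = 0 := by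
            linear_combination h5
          rw [ZMod.natCast_eq_zero_iff] at h6
          refine Nat.le_of_dvd ?_ h6
          rcases hj'.2.2 with h7 | h7 <;> have := gain_of_go h7 <;> omega
        obtain ⟨u3, hu3⟩ := h3.role true
        obtain ⟨u3', hu3'⟩ := h3.role false
        exact ⟨h2.cover (by omega), e true, swapped_explorers (h.ne true) (h.ne_third true)
          (h.ne_third false) (joined_self _) hj (h3.running _) hu3 hu3'⟩
    · exact Or.inl (hfin h2 (by omega) ⟨w, h4⟩)
  · left
    obtain ⟨g, h3, h4, h5⟩ := crossed_eq_true.1 hcr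
    have : r + 1 = n := by
      rcases h.goes_eq (cut := cut) true with ht | ht <;> rw [ht] at h3
      · simp at h3
      · obtain rfl : true = g := by simpa using h3
        exact (h.edge_eq_iff hr).1 h5
    exact hfin h2 (by omega) ⟨e true, swapped_explorers (h.ne true) (h.ne_third true)
          (h.ne_third false) (crossed_self _) hcr (h2.running _) hut huf⟩

end Duo

end

section

variable {n : ℕ} {S : Setup n} {c : Config n (ℕ × Role)} {x : Bool} {P : Fin 3 → Fin 3 → Bool}
  {ω : Coins} {W : Finset (Fin 3)} {cut : Option (ZMod n)} {V V' : Set (ZMod n)}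

/-! ### Distances -/

/-- The distance from `p` to `q` in direction `g`. -/
def gap (p q : ZMod n) (g : Bool) : ℕ := if g then (q - p).val else (p - q).val

theorem gap_lt [NeZero n] (p q : ZMod n) (g : Bool) : gap p q g < n := by
  unfold gap; split <;> exact ZMod.val_lt _

@[simp] theorem gap_self (p : ZMod n) (g : Bool) : gap p p g = 0 := by
  unfold gap; split <;> simp

theorem val_sub_one_add_one (hn : 3 ≤ n) {a : ZMod n} (ha : a ≠ 0) : (a - 1).val + 1 = a.val := by
  have : NeZero n := ⟨by omega⟩
  have : Fact (1 < n) := ⟨by omega⟩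
  have h0 : a.val ≠ 0 := by simpa using ha
  rw [ZMod.val_sub (by rw [ZMod.val_one]; omega), ZMod.val_one]
  omega

theorem gap_neighbour_left (hn : 3 ≤ n) {p q : ZMod n} (h : p ≠ q) (g : Bool) :
    gap (neighbour p g) q g + 1 = gap p q g := by
  cases g
  · have := val_sub_one_add_one hn (sub_ne_zero.2 h)
    simp only [gap, neighbour, Bool.false_eq_true, if_false]
    rw [← this]
    congr 2
    ring
  · have := val_sub_one_add_one hn (sub_ne_zero.2 h.symm)
    simp only [gap, neighbour, if_true]
    rw [← this]
    congr 2
    ring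

theorem gap_neighbour_right (hn : 3 ≤ n) {p q : ZMod n} (h : p ≠ q) (g : Bool) :
    gap p (neighbour q (!g)) g + 1 = gap p q g := by
  cases g
  · have := val_sub_one_add_one hn (sub_ne_zero.2 h)
    simp only [gap, neighbour, Bool.not_false, Bool.false_eq_true, if_false, if_true]
    rw [← this]
    congr 2
    ring
  · have := val_sub_one_add_one hn (sub_ne_zero.2 h.symm)
    simp only [gap, neighbour, Bool.not_true, Bool.false_eq_true, if_false, if_true]
    rw [← this]
    congr 2
    ring

theorem neighbour_injective (g : Bool) : Function.Injective (fun p : ZMod n => neighbour p g) := by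
  intro p q h
  cases g <;> simpa [neighbour] using h

theorem edgeFrom_injective (g : Bool) : Function.Injective (fun p : ZMod n => edgeFrom p g) := by
  intro p q h
  cases g <;> simpa [edgeFrom] using h

theorem edgeFrom_not_iff {p q : ZMod n} (g : Bool) :
    edgeFrom p g = edgeFrom q (!g) ↔ neighbour p g = q := by
  cases g
  · simp only [edgeFrom, neighbour, Bool.not_false, Bool.false_eq_true, if_false, if_true]
  · simp only [edgeFrom, neighbour, Bool.not_true, Bool.false_eq_true, if_false, if_true]
    exact eq_sub_iff_add_eq

/-! ### The foundation of a pair of explorers -/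

/-- The robots know their IDs. -/
def Named (S : Setup n) (c : Config n (ℕ × Role)) : Prop := ∀ i, (c i).mem.1 = S.ids i

/-- With totality and transitivity below, `before` is a strict linear order: waiting robots come
first and distinct IDs break ties. -/
theorem before_asymm {i j : Fin 3} (h : before S c i j = true) : before S c j i = false := by
  revert h
  simp only [before]
  cases gp S c i <;> cases gp S c j <;> simp
  all_goals exact le_of_lt

theorem before_total (h : Named S c) {i j : Fin 3} (hij : i ≠ j) :
    before S c i j = true ∨ before S c j i = true := by
  have : S.ids i ≠ S.ids j := fun h => hij (S.ids_injective h)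
  simp only [before, h i, h j]
  cases gp S c i <;> cases gp S c j <;> simp <;> omega

theorem before_trans {i j k : Fin 3} (h : before S c i j = true) (h' : before S c j k = true) :
    before S c i k = true := by
  revert h h'
  simp only [before]
  cases gp S c i <;> cases gp S c j <;> cases gp S c k <;> simp
  all_goals exact lt_trans

/-- Robots none of which explores come together. -/
structure Gathered (S : Setup n) (V : Set (ZMod n)) (c : Config n (ℕ × Role))
    (P : Fin 3 → Fin 3 → Bool) : Prop where
  running : ∀ i, (c i).halted = false
  wanders : ∀ i, (gr S c i).wanders = true
  meets : ∀ i j, P i j = true ↔ i ≠ j ∧ (c i).pos = (c j).pos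
  port : ∀ i j, i ≠ j → (c i).pos = (c j).pos → gp S c i = none ∨ gp S c j = none
  visited : ∀ i, (c i).pos ∈ V

theorem Gathered.found_of_sorted (h : Gathered S V c P) {i j k : Fin 3} (hij : i ≠ j) (hik : i ≠ k)
    (hjk : j ≠ k) (hp : (c i).pos = (c j).pos) (hb : before S c i j = true)
    (hk : (c i).pos = (c k).pos → before S c i k = true ∧ before S c j k = true) :
    ∃ e w g, Duo S V (swapped S false P c) e w 0 ∧ gp S (swapped S false P c) (e g) = none := by
  have hPself : ∀ l, P l l = false := fun l => by
    rw [← Bool.not_eq_true, h.meets]; simp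
  have hPij : P i j = true := (h.meets i j).2 ⟨hij, hp⟩
  have hPji : P j i = true := (h.meets j i).2 ⟨hij.symm, hp.symm⟩
  have hi := swapped_first hij hik hjk (hPself i) hPij (h.running i) h.wanders (before_asymm hb)
    (fun hP => before_asymm (hk ((h.meets i k).1 hP).2).1)
  have hj := swapped_second hij.symm hjk hik (hPself j) hPji (h.running j) h.wanders hb
    (fun hP => before_asymm (hk (hp.trans ((h.meets j k).1 hP).2)).2)
  have hw : (gr S (swapped S false P c) k).wanders = true := by
    by_cases hpk : (c i).pos = (c k).pos
    · obtain ⟨d, hd⟩ := swapped_third hik.symm hjk.symm hij (hPself k)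
        ((h.meets k i).2 ⟨hik.symm, hpk.symm⟩) ((h.meets k j).2 ⟨hjk.symm, hpk.symm.trans hp⟩)
        (h.running k) h.wanders (hk hpk).1 (hk hpk).2
      rw [hd]; rfl
    · rw [gr_congr (swapped_alone fun l => ?_)]
      · exact h.wanders k
      · rw [← Bool.not_eq_true, h.meets]
        rintro ⟨h1, h2⟩
        have : l = i ∨ l = j := by
          clear hPij hPji hi hj hp hb hk hpk h2
          revert i j k l; decide
        rcases this with rfl | rfl
        · exact hpk h2.symm
        · exact hpk (hp.trans h2.symm)
  -- At most one robot at a node waits, and it would precede the others. So the second explorer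
  -- occupies no port, in particular none that contradicts its new direction.
  have hgj : gp S c j = none := by
    have := h.port i j hij hp
    revert hb this
    simp only [before]
    cases gp S c i <;> cases gp S c j <;> simp
  have hgi : gp S c i = none ∨ gp S c i = some (lead S c i) := by
    simp only [gp, lead]
    cases (c i).port <;> simp
  have he : ∀ g, (if g = lead S c i then i else j) = i ∧ g = lead S c i ∨
      (if g = lead S c i then i else j) = j ∧ g = !lead S c i := fun g => by
    by_cases hg : g = lead S c i
    · simp [hg]
    · simp [Bool.eq_not.2 hg]
  refine ⟨fun g => if g = lead S c i then i else j, k, !lead S c i, ?_, ?_⟩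
  · refine ⟨?_, ?_, ?_, ?_, hw, ?_, ?_, ?_, ?_⟩
    · intro g
      rcases he g with ⟨-, rfl⟩ | ⟨-, rfl⟩
      · simpa using hij
      · simpa using hij.symm
    · intro g
      rcases he g with ⟨h1, -⟩ | ⟨h1, -⟩ <;> simp only [h1]
      exacts [hik, hjk]
    · intro l; rw [swapped_halted, h.running]
    · intro g
      rcases he g with ⟨h1, h2⟩ | ⟨h1, h2⟩ <;> simp only [h1]
      · exact ⟨_, by rw [hi, h2]⟩
      · exact ⟨_, by rw [hj, h2]⟩
    · intro g
      rcases he g with ⟨h1, h2⟩ | ⟨h1, h2⟩ <;> simp only [h1, swapped_gp]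
      · rwa [h2]
      · exact Or.inl hgj
    · have hpos : ∀ g, (c (if g = lead S c i then i else j)).pos = (c i).pos := fun g => by
        rcases he g with ⟨h1, -⟩ | ⟨h1, -⟩ <;> simp only [h1, hp]
      simp only [swapped_pos, hpos]
      simp
    · intro l hl
      obtain rfl : l = 0 := by omega
      simpa using h.visited _
    · intro g _ hg
      rcases he g with ⟨h1, h2⟩ | ⟨h1, h2⟩ <;> simp only [h1] at hg
      · rw [hi] at hg; simp at hg
      · rw [hj] at hg; simp at hg
  · simpa using hgj

/-- It suffices to sort the robots at the meeting node. Only the place of a third robot at the same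
node needs a case distinction. -/
theorem Gathered.found (h : Gathered S V c P) (hN : Named S c) {i j : Fin 3} (hij : i ≠ j)
    (hp : (c i).pos = (c j).pos) :
    ∃ e w g, Duo S V (swapped S false P c) e w 0 ∧ gp S (swapped S false P c) (e g) = none := by
  wlog hb : before S c i j = true generalizing i j
  · exact this hij.symm hp.symm ((before_total hN hij).resolve_left hb)
  obtain ⟨k, hik, hjk⟩ : ∃ k : Fin 3, i ≠ k ∧ j ≠ k := by
    clear hp hb; revert i j; decide
  by_cases hk : (c i).pos = (c k).pos
  · rcases before_total hN hjk with h1 | h1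
    · exact h.found_of_sorted hij hik hjk hp hb fun _ => ⟨before_trans hb h1, h1⟩
    · rcases before_total hN hik with h2 | h2
      · exact h.found_of_sorted hik hij hjk.symm hk h2 fun _ => ⟨hb, h1⟩
      · exact h.found_of_sorted hik.symm hjk.symm hij hk.symm h2 fun _ => ⟨h1, hb⟩
  · exact h.found_of_sorted hij hik hjk hp hb fun h => (hk h).elim

/-! ### Three walkers -/

/-- The robots walk on distinct nodes, robot `z` in direction `!g` and the others in direction
`g`. -/
structure Trio (S : Setup n) (ω : Coins) (c : Config n (ℕ × Role)) (z : Fin 3) (g : Bool) :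
    Prop where
  running : ∀ i, (c i).halted = false
  apart : ∀ i j, (c i).pos = (c j).pos → i = j
  heads : ∀ i, ∃ f, Heads S ω c i (if i = z then !g else g) f
  port : ∀ i, gp S c i = none ∨ gp S c i = some (if i = z then !g else g)
  active : ∀ i, gp S c i ≠ none → gr S c i ≠ .fresh

theorem Heads.wanders {i : Fin 3} {d f : Bool} (h : Heads S ω c i d f) :
    (gr S c i).wanders = true := by
  rcases h with h | ⟨h, -⟩ <;> rw [h] <;> rfl

theorem neighbour_ne_self (hn : 3 ≤ n) (p : ZMod n) (g : Bool) : neighbour p g ≠ p := by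
  have : Fact (1 < n) := ⟨by omega⟩
  cases g <;> simp [neighbour]

namespace Trio

variable {z : Fin 3} {g : Bool}

/-- A walker alone on its node sees no explorer, so it never turns, and a fresh robot takes the
direction announced by its pending bit. -/
theorem computed_one (h : Trio S ω c z g) (i : Fin 3) :
    (DynamicRing.computed S ω W c i).halted = false ∧
    (∃ f, Heads S ω (DynamicRing.computed S ω W c) i (if i = z then !g else g) f) ∧
    (DynamicRing.computed S ω W c i = c i ∧ i ∉ W ∨
      gp S (DynamicRing.computed S ω W c) i = some (if i = z then !g else g) ∧
      gr S (DynamicRing.computed S ω W c) i ≠ .fresh) := by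
  obtain ⟨f, hf⟩ := h.heads i
  by_cases hW : i ∈ W
  · obtain ⟨h1, h2, h3⟩ := computed_walker hW (h.running i) hf
      (Or.inl ⟨fun j hj hp => (hj (h.apart _ _ hp)).elim, rfl, rfl⟩)
    exact ⟨h3, ⟨f, Or.inl h1⟩, Or.inr ⟨h2, by simp [h1]⟩⟩
  · have hc := computed_asleep (S := S) (c := c) (ω := ω) hW
    refine ⟨by rw [hc, h.running], ⟨f, ?_⟩, Or.inl ⟨hc, hW⟩⟩
    unfold Heads at *
    rwa [gr_congr hc, hc]

theorem computed (h : Trio S ω c z g) : Trio S ω (computed S ω W c) z g where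
  running i := (h.computed_one i).1
  apart := by simpa using h.apart
  heads i := (h.computed_one i).2.1
  port i := by
    rcases (h.computed_one (W := W) i).2.2 with ⟨h1, -⟩ | h1
    · rw [gp_congr h1]; exact h.port i
    · exact Or.inr h1.1
  active i hi := by
    rcases (h.computed_one (W := W) i).2.2 with ⟨h1, -⟩ | h1
    · rw [gr_congr h1]
      rw [gp_congr h1] at hi
      exact h.active i hi
    · exact h1.2

theorem walks (h : Trio S ω c z g) {i : Fin 3} (hi : gp S c i ≠ none) :
    ∃ f, gr S c i = .walk (if i = z then !g else g) f := by
  obtain ⟨f, hf | ⟨hf, -⟩⟩ := h.heads i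
  · exact ⟨f, hf⟩
  · exact (h.active i hi hf).elim

theorem goes_eq (h : Trio S ω c z g) {i : Fin 3} {d : Bool} (hd : goes S cut c i = some d) :
    d = if i = z then !g else g := by
  have := (goes_eq_some.1 hd).1
  rcases h.port i with h1 | h1 <;> simp_all

/-- Some robot can move, or is not yet waiting. -/
theorem exists_idle (h : Trio S ω c z g) : ∃ i, gp S (relocate S cut c) i = none := by
  by_contra hno
  push Not at hno
  obtain ⟨i, j, hi, hj, hij⟩ : ∃ i j : Fin 3, i ≠ z ∧ j ≠ z ∧ i ≠ j := by
    clear h; revert z; decide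
  have hcut : ∀ i, i ≠ z → cut = some (edgeFrom (c i).pos g) := fun i hi => by
    obtain ⟨h1, h2⟩ := goes_of_relocate_gp (hno i)
    have := (h.port i).resolve_left (by rw [h2]; exact hno i)
    rw [if_neg hi] at this
    exact goes_eq_none h1 this
  have := (hcut i hi).symm.trans (hcut j hj)
  exact hij (h.apart _ _ (edgeFrom_injective g (by simpa using this)))

theorem gathered (h : Trio S ω c z g) (hp : ∀ i, (relocate S cut c i).pos ∈ V') :
    Gathered S V' (relocate S cut c) (joined S cut c) where
  running i := by rw [relocate_halted, h.running]
  wanders i := by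
    obtain ⟨f, hf⟩ := h.heads i
    rw [relocate_gr, hf.wanders]
  meets i j := by
    rw [joined_eq_true]
    refine ⟨fun h => ⟨h.1, h.2.1⟩, fun h' => ⟨h'.1, h'.2, ?_⟩⟩
    by_contra hno
    push Not at hno
    rw [relocate_stay hno.1, relocate_stay hno.2] at h'
    exact h'.1 (h.apart _ _ h'.2)
  port i j hij hp := by
    by_contra hno
    push Not at hno
    have h1 := (goes_of_relocate_gp hno.1).1
    have h2 := (goes_of_relocate_gp hno.2).1
    rw [relocate_stay h1, relocate_stay h2] at hp
    exact hij (h.apart _ _ hp)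
  visited := hp

/-- Two of the walkers cross each other. -/
theorem cross (hn : 3 ≤ n) (h : Trio S ω c z g) (hp : ∀ i, (relocate S cut c i).pos ∈ V')
    {i j : Fin 3} (hc : crossed S cut c i j = true) :
    ∃ e w d, Duo S V' (transported S cut c) e w 1 ∧
      gp S (transported S cut c) (e d) = none := by
  have : Fact (1 < n) := ⟨by omega⟩
  -- Crossing robots have opposite directions, so one of them is `z`.
  obtain ⟨i, hiz, hc⟩ : ∃ i, i ≠ z ∧ crossed S cut c i z = true := by
    obtain ⟨d, h1, h2, -⟩ := crossed_eq_true.1 hc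
    have h1 := h.goes_eq h1
    have h2 := h.goes_eq h2
    by_cases hj : j = z
    · subst hj
      refine ⟨i, ?_, hc⟩
      rintro rfl
      rw [h1] at h2
      simp at h2
    · rw [if_neg hj] at h2
      have hi : i = z := by
        by_contra hi
        rw [if_neg hi] at h1
        rw [h1] at h2
        simp at h2
      subst hi
      exact ⟨j, hj, by rwa [crossed_comm]⟩
  clear! j
  obtain ⟨d, h1, h2, h3⟩ := crossed_eq_true.1 hc
  obtain rfl : d = g := by rw [h.goes_eq h1, if_neg hiz]
  obtain ⟨w, hiw, hzw⟩ : ∃ w : Fin 3, i ≠ w ∧ z ≠ w := by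
    clear * -; revert i z; decide
  have hwi : crossed S cut c i w = false := by
    rw [← Bool.not_eq_true, crossed_eq_true]
    rintro ⟨d', h4, h5, -⟩
    have h4 := h.goes_eq h4
    have h5 := h.goes_eq h5
    rw [if_neg hiz] at h4
    rw [if_neg hzw.symm] at h5
    rw [h4] at h5
    simp at h5
  have hwz : crossed S cut c z w = false := by
    rw [← Bool.not_eq_true, crossed_eq_true]
    rintro ⟨d', h4, h5, h6⟩
    rw [h2] at h4
    obtain rfl : (!d) = d' := by simpa using h4
    rw [Bool.not_not] at h6
    exact hiw (h.apart _ _ (edgeFrom_injective d (h3.trans h6)))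
  have hwand : ∀ l, (gr S (relocate S cut c) l).wanders = true := (h.gathered hp).wanders
  have hrun : ∀ l, (relocate S cut c l).halted = false := (h.gathered hp).running
  obtain ⟨fi, hfi⟩ : ∃ f, gr S (relocate S cut c) i = .walk d f := by
    have := h.walks (i := i) (by rw [(goes_eq_some.1 h1).1]; simp)
    rwa [if_neg hiz, ← relocate_gr (S := S) (cut := cut)] at this
  obtain ⟨fz, hfz⟩ : ∃ f, gr S (relocate S cut c) z = .walk (!d) f := by
    have := h.walks (i := z) (by rw [(goes_eq_some.1 h2).1]; simp)
    rwa [if_pos rfl, ← relocate_gr (S := S) (cut := cut)] at this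
  have hi := swapped_crossing hiz hiw hzw (crossed_self i) hc hwi (hrun i) hfi (hwand z)
  have hz := swapped_crossing hiz.symm hzw hiw (crossed_self z) (by rwa [crossed_comm]) hwz
    (hrun z) hfz (hwand i)
  have hw : swapped S true (crossed S cut c) (relocate S cut c) w = relocate S cut c w := by
    refine swapped_alone fun l => ?_
    have : l = i ∨ l = z ∨ l = w := by
      clear * - hiw hzw hiz; revert i z w l; decide
    rcases this with rfl | rfl | rfl
    · rw [crossed_comm, hwi]
    · rw [crossed_comm, hwz]
    · exact crossed_self _
  have he : ∀ g, (if g = d then i else z) = i ∧ g = d ∨ (if g = d then i else z) = z ∧ g = !d := by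
    intro g
    by_cases hg : g = d
    · simp [hg]
    · simp [Bool.eq_not.2 hg]
  have hgp : ∀ g, gp S (swapped S true (crossed S cut c) (relocate S cut c))
      (if g = d then i else z) = none := fun g => by
    rw [swapped_gp]
    rcases he g with ⟨h4, -⟩ | ⟨h4, -⟩ <;> rw [h4]
    · exact relocate_gp_of_go h1
    · exact relocate_gp_of_go h2
  -- Crossing exchanges the ends of one edge, which gives an arc of length one whose ends already
  -- face outwards.
  have hsep : (relocate S cut c (if true = d then i else z)).pos =
      (relocate S cut c (if false = d then i else z)).pos + 1 := by
    rw [edgeFrom_not_iff] at h3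
    cases d
    · simp only [Bool.true_eq_false, if_false, if_true, relocate_go h1, relocate_go h2, ← h3]
      simp [neighbour]
    · simp only [Bool.false_eq_true, if_false, if_true, relocate_go h1, relocate_go h2, ← h3]
      simp [neighbour]
  have hduo : Duo S V' (swapped S true (crossed S cut c) (relocate S cut c))
      (fun g => if g = d then i else z) w 1 := by
    refine ⟨?_, ?_, ?_, ?_, ?_, ?_, ?_, ?_, ?_⟩
    · intro g
      rcases he g with ⟨-, rfl⟩ | ⟨-, rfl⟩
      · simpa using hiz
      · simpa using hiz.symm
    · intro g
      rcases he g with ⟨h4, -⟩ | ⟨h4, -⟩ <;> simp only [h4]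
      exacts [hiw, hzw]
    · intro l; rw [swapped_halted, hrun]
    · intro g
      rcases he g with ⟨h4, rfl⟩ | ⟨h4, rfl⟩ <;> simp only [h4]
      · exact ⟨_, hi⟩
      · exact ⟨_, hz⟩
    · rw [gr_congr hw, hwand]
    · exact fun g => Or.inl (hgp g)
    · simpa using hsep
    · intro k hk
      have hk' : k = 0 ∨ k = 1 := by omega
      rcases hk' with rfl | rfl
      · simpa using hp _
      · simp only [swapped_pos, Nat.cast_one, ← hsep]
        exact hp _
    · exact fun g _ _ h => (h (hgp g)).elim
  rcases hduo.swapped (x := false) (P := joined S cut c) (fun hb => (hb true (hgp true)).elim)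
    joined_self joined_comm (by
      rw [← Bool.not_eq_true, joined_eq_true]
      rintro ⟨-, h4, -⟩
      rw [hsep] at h4
      simp at h4) with h4 | ⟨h4, -⟩
  · exact ⟨_, w, true, h4, by rw [transported_eq, swapped_gp]; exact hgp true⟩
  -- A finishing walker would need `1 + 1 = n`, contrary to `3 ≤ n`.
  · omega

/-- The walkers do not meet. -/
theorem relocate (h : Trio S ω c z g)
    (hj : ∀ i j, joined S cut c i j = false) : Trio S ω (relocate S cut c) z g where
  running i := by rw [relocate_halted, h.running]
  apart i j hp := by
    by_contra hij
    exact absurd (((h.gathered (V' := Set.univ) (by simp)).meets i j).2 ⟨hij, hp⟩) (by simp [hj])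
  heads i := by
    simp only [Heads, relocate_gr, relocate_coins]
    exact h.heads i
  port i := by
    by_cases hg : gp S (DynamicRing.relocate S cut c) i = none
    · exact Or.inl hg
    · rw [← (goes_of_relocate_gp hg).2]; exact h.port i
  active i hi := by
    rw [relocate_gr]
    exact h.active i (by rw [(goes_of_relocate_gp hi).2]; exact hi)

/-- Moves of `i` and of `z` each shorten the distance between them by one. The exclusion of
crossings prevents a wrap-around when both move at distance one. -/
theorem gap_relocate (hn : 3 ≤ n) (h : Trio S ω c z g) (hc : ∀ i j, crossed S cut c i j = false)
    {i : Fin 3} (hi : i ≠ z) :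
    gap (DynamicRing.relocate S cut c i).pos (DynamicRing.relocate S cut c z).pos g +
      gain S cut c i + gain S cut c z = gap (c i).pos (c z).pos g := by
  have hne : (c i).pos ≠ (c z).pos := fun hp => hi (h.apart _ _ hp)
  cases h1 : goes S cut c i with
  | none =>
    rw [relocate_stay h1, gain_of_stay h1]
    cases h2 : goes S cut c z with
    | none => rw [relocate_stay h2, gain_of_stay h2]; rfl
    | some d =>
      obtain rfl : d = !g := by simpa using h.goes_eq h2
      rw [relocate_go h2, gain_of_go (by simp [h2])]
      exact gap_neighbour_right hn hne g
  | some d =>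
    obtain rfl : d = g := by simpa [hi] using h.goes_eq h1
    rw [relocate_go h1, gain_of_go (by simp [h1])]
    cases h2 : goes S cut c z with
    | none =>
      rw [relocate_stay h2, gain_of_stay h2]
      exact gap_neighbour_left hn hne d
    | some d' =>
      obtain rfl : d' = !d := by simpa using h.goes_eq h2
      rw [relocate_go h2, gain_of_go (by simp [h2])]
      have hne' : neighbour (c i).pos d ≠ (c z).pos := fun h3 => by
        refine absurd (crossed_eq_true.2 ⟨d, h1, h2, (edgeFrom_not_iff d).2 h3⟩) ?_
        simp [hc]
      have h3 := gap_neighbour_left hn hne d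
      have h4 := gap_neighbour_right hn hne' d
      simp only
      omega

end Trio

end

section

variable {n : ℕ} {S : Setup n} {c : Config n (ℕ × Role)} {x : Bool} {P : Fin 3 → Fin 3 → Bool}
  {ω : Coins} {W : Finset (Fin 3)} {cut : Option (ZMod n)} {V V' : Set (ZMod n)}

/-! ### Progress -/

/-- Whether robot `i` is not trying to move. -/
def idle (S : Setup n) (c : Config n (ℕ × Role)) (i : Fin 3) : ℕ :=
  if gp S c i = none then 1 else 0

/-- The number of explorers that the walker still has to meet after the next one, when both
explorers wait on their ports. The flags are those of the walker, of the explorer towards which it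
walks, and of the other explorer. -/
def level (f u u' : Bool) : ℕ := if f && u then 0 else if u' then 1 else 2

/-- The configuration `c` has rank `k`, and the rank decreases at the latest when robot `i` is
activated. -/
inductive Good (S : Setup n) (ω : Coins) (V : Set (ZMod n)) (c : Config n (ℕ × Role)) :
    Fin 3 → ℕ → Prop
  -- The ranks lie in separate bands, so changing to a later phase always lowers them: `0`; `1`;
  -- from `3` to `3 * n + 1` for `nearing`; `3 * n + 2`; above that and below `5 * n + 6` for `duo`;
  -- at least `5 * n + 6` for `trio`.
  | halted (i j : Fin 3) (hV : V = Set.univ) (hj : (c j).halted = true) : Good S ω V c i 0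
  | known (i : Fin 3) (hV : V = Set.univ) (hi : gr S c i = .finished) : Good S ω V c i 1
  | nearing (e : Bool → Fin 3) (w : Fin 3) (r : ℕ) (d f : Bool) (u : Bool → Bool)
      (hD : Duo S V c e w r) (hr : r + 1 = n) (hb : Blocked S c e) (hw : gr S c w = .walk d f)
      (hp : gp S c w = none ∨ gp S c w = some d) (hu : ∀ g, gr S c (e g) = .explore g (u g))
      (hne : (c w).pos ≠ (c (e d)).pos) :
      Good S ω V c w (2 + level f (u d) (u (!d)) * n + gap (c w).pos (c (e d)).pos d)
  | blocked (e : Bool → Fin 3) (w : Fin 3) (r : ℕ)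
      (hD : Duo S V c e w r) (hr : r + 1 = n) (hb : Blocked S c e) : Good S ω V c w (3 * n + 2)
  | duo (e : Bool → Fin 3) (w : Fin 3) (r : ℕ) (g : Bool) (hD : Duo S V c e w r) (hr : r < n)
      (hg : gp S c (e g) = none) :
      Good S ω V c (e g) (3 * n + 3 + 2 * (n - r) + idle S c (e true) + idle S c (e false))
  | trio (z : Fin 3) (g : Bool) (i : Fin 3) (hT : Trio S ω c z g) (hi : gp S c i = none) :
      Good S ω V c i (5 * n + 6 + 2 * ∑ j, gap (c j).pos (c z).pos g + ∑ j, idle S c j)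

theorem idle_le (i : Fin 3) : idle S c i ≤ 1 := by
  unfold idle; split <;> simp

theorem level_le (f u u' : Bool) : level f u u' ≤ 2 := by
  revert f u u'; decide

theorem Good.le (hn : 3 ≤ n) {i : Fin 3} {k : ℕ} (h : Good S ω V c i k) : k ≤ 13 * n := by
  have : NeZero n := ⟨by omega⟩
  cases h with
  | halted => omega
  | known => omega
  | nearing e w r d f u =>
    have := gap_lt (c i).pos (c (e d)).pos d
    have := Nat.mul_le_mul_right n (level_le f (u d) (u (!d)))
    omega
  | blocked => omega
  | duo e =>
    have := idle_le (S := S) (c := c) (e true)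
    have := idle_le (S := S) (c := c) (e false)
    omega
  | trio z g =>
    have h1 := fun i => gap_lt (c i).pos (c z).pos g
    have h2 : gap (c z).pos (c z).pos g = 0 := gap_self _ _
    have h3 := fun i => idle_le (S := S) (c := c) i
    have h4 := h1 0
    have h5 := h1 1
    have h6 := h1 2
    have h7 := h3 0
    have h8 := h3 1
    have h9 := h3 2
    simp only [Fin.sum_univ_three]
    fin_cases z <;> simp only [Fin.zero_eta, Fin.mk_one, Fin.reduceFinMk] at * <;> omega

/-- The rank decreases, or the robot whose activation decreases the rank is asleep. -/
def Progress (S : Setup n) (ω : Coins) (V : Set (ZMod n)) (W : Finset (Fin 3))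
    (c : Config n (ℕ × Role)) (i : Fin 3) (k : ℕ) : Prop :=
  (∃ i' k', k' < k ∧ Good S ω V c i' k') ∨ (i ∉ W ∧ Good S ω V c i k)

theorem Known.good (h : Known S V c) : ∃ i, Good S ω V c i 1 := by
  obtain ⟨hV, i, hi⟩ := h
  exact ⟨i, .known i hV hi⟩

theorem Known.progress {i : Fin 3} {k : ℕ} (h : Known S V c) (hk : 1 < k) :
    Progress S ω V W c i k := by
  obtain ⟨j, hj⟩ := h.good (ω := ω)
  exact Or.inl ⟨j, 1, hk, hj⟩

theorem transported_gp (i : Fin 3) :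
    gp S (transported S cut c) i = gp S (relocate S cut c) i := by
  rw [transported_eq, swapped_gp, swapped_gp]

theorem idle_relocate (i : Fin 3) :
    idle S (relocate S cut c) i = if goes S cut c i = none then idle S c i else 1 := by
  cases h : goes S cut c i
  · simp [idle, gp_congr (relocate_stay h)]
  · simp [idle, relocate_gp_of_go h]

/-- Each move of an explorer lowers `2 * (n - r)` by two and raises the number of idle explorers by
at most one. Without moves, activating the idle explorer `e g` puts it on its port. If both wait
after the moves, the rank falls to that of `blocked`. -/
theorem Duo.progress [NeZero n] {e : Bool → Fin 3} {w : Fin 3} {r : ℕ} {g : Bool}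
    (h : Duo S V c e w r) (hr : r < n) (hg : gp S c (e g) = none) (hV : V ⊆ V')
    (hp : ∀ i, (DynamicRing.relocate S cut (DynamicRing.computed S ω W c) i).pos ∈ V') :
    Progress S ω V' W (DynamicRing.transported S cut (DynamicRing.computed S ω W c)) (e g)
      (3 * n + 3 + 2 * (n - r) + idle S c (e true) + idle S c (e false)) := by
  have h1 : Duo S V (DynamicRing.computed S ω W c) e w r := h.computed
  rcases h1.transported hr hV hp with hk | ⟨h2, hr', hb⟩
  · exact hk.progress (by omega)
  by_cases hbl : Blocked S (DynamicRing.transported S cut (DynamicRing.computed S ω W c)) e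
  · exact Or.inl ⟨w, _, by omega, .blocked e w _ h2 (hb hbl) hbl⟩
  have hidle : ∀ d, idle S (DynamicRing.computed S ω W c) (e d) ≤ idle S c (e d) ∧
      (e d ∈ W → idle S (DynamicRing.computed S ω W c) (e d) = 0) := fun d => by
    obtain ⟨-, h3, h4, -⟩ := h.explorer_computed (ω := ω) (W := W) d
    constructor
    · by_cases h5 : gp S c (e d) = none
      · simp [idle, h5]
        split <;> simp
      · simp [idle, h5, h4 h5]
    · intro hW
      simp [idle, h3 hW]
  have hg1 : idle S c (e g) = 1 := by simp [idle, hg]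
  have hidle' : ∀ d, idle S (DynamicRing.transported S cut (DynamicRing.computed S ω W c)) (e d) =
      if goes S cut (DynamicRing.computed S ω W c) (e d) = none then
        idle S (DynamicRing.computed S ω W c) (e d) else 1 := fun d => by
    rw [← idle_relocate, idle, idle, transported_gp]
  have hgain : ∀ d, gain S cut (DynamicRing.computed S ω W c) (e d) =
      if goes S cut (DynamicRing.computed S ω W c) (e d) = none then 0 else 1 := fun d => rfl
  have hsum : ∀ d, idle S (DynamicRing.transported S cut (DynamicRing.computed S ω W c)) (e d) ≤
      idle S c (e d) + gain S cut (DynamicRing.computed S ω W c) (e d) := fun d => by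
    rw [hidle', hgain]
    have := (hidle d).1
    split <;> omega
  have hst := hsum true
  have hsf := hsum false
  by_cases hw : e g ∉ W ∧ gain S cut (DynamicRing.computed S ω W c) (e true) = 0 ∧
      gain S cut (DynamicRing.computed S ω W c) (e false) = 0
  · obtain ⟨hW, ht, hf⟩ := hw
    have hg2 : gp S (DynamicRing.transported S cut (DynamicRing.computed S ω W c)) (e g) = none := by
      have hs : goes S cut (DynamicRing.computed S ω W c) (e g) = none := by
        by_contra hs
        have := gain_of_go hs
        cases g <;> omega
      rw [transported_gp, gp_congr (relocate_stay hs), gp_congr (computed_asleep hW), hg]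
    have := Good.duo (ω := ω) e w _ g h2 hr' hg2
    simp only [ht, hf, add_zero] at *
    rcases Nat.lt_or_ge
      (idle S (DynamicRing.transported S cut (DynamicRing.computed S ω W c)) (e true) +
        idle S (DynamicRing.transported S cut (DynamicRing.computed S ω W c)) (e false))
      (idle S c (e true) + idle S c (e false)) with hlt | hge
    · exact Or.inl ⟨_, _, by omega, this⟩
    · have ht' : idle S (DynamicRing.transported S cut (DynamicRing.computed S ω W c)) (e true) =
        idle S c (e true) := by omega
      have hf' : idle S (DynamicRing.transported S cut (DynamicRing.computed S ω W c)) (e false) =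
        idle S c (e false) := by omega
      rw [ht', hf'] at this
      exact Or.inr ⟨hW, this⟩
  · obtain ⟨d, hd⟩ : ∃ d, gp S
        (DynamicRing.transported S cut (DynamicRing.computed S ω W c)) (e d) = none := by
      by_contra hno
      push Not at hno
      exact hbl hno
    refine Or.inl ⟨_, _, ?_, Good.duo (ω := ω) e w _ d h2 hr' hd⟩
    by_cases hpos : gain S cut (DynamicRing.computed S ω W c) (e true) = 0 ∧
      gain S cut (DynamicRing.computed S ω W c) (e false) = 0
    · have hW : e g ∈ W := by tauto
      have hs : goes S cut (DynamicRing.computed S ω W c) (e g) = none := by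
        by_contra hs
        have := gain_of_go hs
        cases g <;> omega
      have h3 := hidle' g
      rw [if_pos hs, (hidle g).2 hW] at h3
      cases g <;> omega
    · omega

theorem idle_eq_of_eq {c' : Config n (ℕ × Role)} {i : Fin 3} (h : c' i = c i) :
    idle S c' i = idle S c i := by rw [idle, idle, gp_congr h]

theorem transported_of_apart (hc : ∀ i j, crossed S cut c i j = false)
    (hj : ∀ i j, joined S cut c i j = false) : transported S cut c = relocate S cut c := by
  have h1 : swapped S true (crossed S cut c) (relocate S cut c) = relocate S cut c :=
    funext fun i => swapped_alone (hc i)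
  rw [transported_eq, h1]
  exact funext fun i => swapped_alone (hj i)

theorem duo_rank_le [NeZero n] {e : Bool → Fin 3} {w : Fin 3} {r : ℕ} {g : Bool}
    (h : Duo S V c e w r) (hr : r < n) (hg : gp S c (e g) = none) :
    ∃ i k, k < 5 * n + 6 ∧ Good S ω V c i k := by
  refine ⟨_, _, ?_, Good.duo (ω := ω) e w r g h hr hg⟩
  have := idle_le (S := S) (c := c) (e true)
  have := idle_le (S := S) (c := c) (e false)
  omega

/-- The potential argument of `Duo.progress`, with distances to `z` in place of the unexplored part.
Any meeting founds a pair of explorers and drops the rank below `5 * n + 6`. -/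
theorem Trio.progress (hn : 3 ≤ n) {z : Fin 3} {g : Bool} {i : Fin 3} (h : Trio S ω c z g)
    (hN : Named S c) (hi : gp S c i = none)
    (hp : ∀ i, (DynamicRing.relocate S cut (DynamicRing.computed S ω W c) i).pos ∈ V') :
    Progress S ω V' W (transported S cut (DynamicRing.computed S ω W c)) i
      (5 * n + 6 + 2 * ∑ j, gap (c j).pos (c z).pos g + ∑ j, idle S c j) := by
  have : NeZero n := ⟨by omega⟩
  have h1 : Trio S ω (DynamicRing.computed S ω W c) z g := h.computed
  by_cases hc : ∃ i j, crossed S cut (DynamicRing.computed S ω W c) i j = true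
  · obtain ⟨a, b, hab⟩ := hc
    obtain ⟨e, w, d, hD, hd⟩ := h1.cross hn hp hab
    obtain ⟨i', k', hk, hG⟩ := duo_rank_le (ω := ω) hD (by omega) hd
    exact Or.inl ⟨i', k', by omega, hG⟩
  have hc' : ∀ i j, crossed S cut (DynamicRing.computed S ω W c) i j = false := by simpa using hc
  have h2 : transported S cut (DynamicRing.computed S ω W c) =
      swapped S false (joined S cut (DynamicRing.computed S ω W c))
        (DynamicRing.relocate S cut (DynamicRing.computed S ω W c)) := by
    rw [transported_eq]
    congr 1
    exact funext fun i => swapped_alone (hc' i)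
  by_cases hj : ∃ i j, joined S cut (DynamicRing.computed S ω W c) i j = true
  · obtain ⟨a, b, hab⟩ := hj
    obtain ⟨hne, heq, -⟩ := joined_eq_true.1 hab
    have hN' : Named S (DynamicRing.relocate S cut (DynamicRing.computed S ω W c)) := fun i => by
      rw [relocate_id, computed_id, hN]
    obtain ⟨e, w, d, hD, hd⟩ := (h1.gathered hp).found hN' hne heq
    rw [← h2] at hD hd
    obtain ⟨i', k', hk, hG⟩ := duo_rank_le (ω := ω) hD (by omega) hd
    exact Or.inl ⟨i', k', by omega, hG⟩
  have hj' : ∀ i j, joined S cut (DynamicRing.computed S ω W c) i j = false := by simpa using hj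
  clear hc hj h2
  rw [transported_of_apart hc' hj']
  have h2 : Trio S ω (DynamicRing.relocate S cut (DynamicRing.computed S ω W c)) z g :=
    h1.relocate hj'
  obtain ⟨i', hi'⟩ := h1.exists_idle (cut := cut)
  have hgood := Good.trio (V := V') z g i' h2 hi'
  have hidle : ∀ j, idle S (DynamicRing.computed S ω W c) j ≤ idle S c j ∧
      (j ∈ W → idle S (DynamicRing.computed S ω W c) j = 0) := fun j => by
    rcases (h.computed_one (W := W) j).2.2 with ⟨h3, h4⟩ | ⟨h3, -⟩
    · exact ⟨(idle_eq_of_eq h3).le, fun h => (h4 h).elim⟩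
    · simp [idle, h3]
  have hsum : ∀ j, idle S (DynamicRing.relocate S cut (DynamicRing.computed S ω W c)) j ≤
      idle S c j + gain S cut (DynamicRing.computed S ω W c) j := fun j => by
    rw [idle_relocate, gain]
    have := (hidle j).1
    split <;> omega
  have hgap : ∀ j, j ≠ z → _ := fun j hj => h1.gap_relocate hn hc' hj
  simp only [computed_pos] at hgap
  have hz : gap (c z).pos (c z).pos g = 0 := gap_self _ _
  have hz' := gap_self (DynamicRing.relocate S cut (DynamicRing.computed S ω W c) z).pos g
  -- A move shortens at least one gap, worth two, and creates at most one idle robot; so each move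
  -- gains at least one.
  have htotal : 2 * ∑ j, gap (DynamicRing.relocate S cut (DynamicRing.computed S ω W c) j).pos
        (DynamicRing.relocate S cut (DynamicRing.computed S ω W c) z).pos g +
      ∑ j, gain S cut (DynamicRing.computed S ω W c) j +
      ∑ j, idle S (DynamicRing.relocate S cut (DynamicRing.computed S ω W c)) j ≤
      2 * ∑ j, gap (c j).pos (c z).pos g + ∑ j, idle S c j := by
    have s0 := hsum 0
    have s1 := hsum 1
    have s2 := hsum 2
    have g0 := hgap 0
    have g1 := hgap 1
    have g2 := hgap 2
    simp only [Fin.sum_univ_three]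
    clear * - s0 s1 s2 g0 g1 g2 hz hz'
    fin_cases z <;> simp at * <;> omega
  by_cases hw : i ∉ W ∧ ∑ j, gain S cut (DynamicRing.computed S ω W c) j = 0
  · obtain ⟨hW, h0⟩ := hw
    have hs : goes S cut (DynamicRing.computed S ω W c) i = none := by
      by_contra hs
      have := gain_of_go hs
      rw [Finset.sum_eq_zero_iff] at h0
      have := h0 i (Finset.mem_univ i)
      omega
    have hi2 : gp S (DynamicRing.relocate S cut (DynamicRing.computed S ω W c)) i = none := by
      rw [gp_congr (relocate_stay hs), gp_congr (computed_asleep hW), hi]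
    have hgood' := Good.trio (V := V') z g i h2 hi2
    rcases Nat.lt_or_ge (5 * n + 6 +
        2 * ∑ j, gap (DynamicRing.relocate S cut (DynamicRing.computed S ω W c) j).pos
          (DynamicRing.relocate S cut (DynamicRing.computed S ω W c) z).pos g +
        ∑ j, idle S (DynamicRing.relocate S cut (DynamicRing.computed S ω W c)) j)
      (5 * n + 6 + 2 * ∑ j, gap (c j).pos (c z).pos g + ∑ j, idle S c j) with hlt | hge
    · exact Or.inl ⟨_, _, hlt, hgood'⟩
    · refine Or.inr ⟨hW, ?_⟩
      convert hgood' using 1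
      omega
  · refine Or.inl ⟨_, _, ?_, hgood⟩
    by_cases h0 : ∑ j, gain S cut (DynamicRing.computed S ω W c) j = 0
    · have hW : i ∈ W := by tauto
      have hstay : ∀ j, goes S cut (DynamicRing.computed S ω W c) j = none := fun j => by
        by_contra hs
        have := gain_of_go hs
        rw [Finset.sum_eq_zero_iff] at h0
        have := h0 j (Finset.mem_univ j)
        omega
      have hlt : ∑ j, idle S (DynamicRing.relocate S cut (DynamicRing.computed S ω W c)) j <
          ∑ j, idle S c j := by
        refine Finset.sum_lt_sum (fun j _ => ?_) ⟨i, Finset.mem_univ i, ?_⟩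
        · rw [idle_relocate, if_pos (hstay j)]
          exact (hidle j).1
        · rw [idle_relocate, if_pos (hstay i), (hidle i).2 hW, idle, if_pos hi]
          exact one_pos
      have hgle : ∑ j, gap (DynamicRing.relocate S cut (DynamicRing.computed S ω W c) j).pos
          (DynamicRing.relocate S cut (DynamicRing.computed S ω W c) z).pos g =
          ∑ j, gap (c j).pos (c z).pos g := by
        refine Finset.sum_congr rfl fun j _ => ?_
        rw [relocate_stay (hstay j), relocate_stay (hstay z), computed_pos, computed_pos]
      omega
    · omega

end

section

variable {n : ℕ} {S : Setup n} {c : Config n (ℕ × Role)} {x : Bool} {P : Fin 3 → Fin 3 → Bool}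
  {ω : Coins} {W : Finset (Fin 3)} {cut : Option (ZMod n)} {V V' : Set (ZMod n)}

/-! ### The walker between waiting explorers -/

theorem transported_pos (i : Fin 3) :
    (transported S cut c i).pos = (relocate S cut c i).pos := by
  rw [transported_eq, swapped_pos, swapped_pos]

namespace Duo

variable {e : Bool → Fin 3} {w : Fin 3} {r : ℕ}

/-- With an arc of `n - 1` steps the explorers are neighbours across the edge that both face. -/
theorem pos_not [NeZero n] (h : Duo S V c e w r) (hr : r + 1 = n) (g : Bool) :
    neighbour (c (e g)).pos g = (c (e (!g))).pos :=
  (edgeFrom_not_iff g).1 (h.edge_eq_not hr g)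

theorem pos_ne_not [NeZero n] (hn : 3 ≤ n) (h : Duo S V c e w r) (hr : r + 1 = n) (g : Bool) :
    (c (e (!g))).pos ≠ (c (e g)).pos := by
  rw [← h.pos_not hr g]
  exact neighbour_ne_self hn _ _

/-- An awake walker that stands with the explorer of its own direction turns around, so afterwards
it is always at positive distance from its target. The last clause says that a walker already under
way keeps direction and flag. -/
theorem walker_computed [NeZero n] (hn : 3 ≤ n) (h : Duo S V c e w r) (hr : r + 1 = n)
    (hW : w ∈ W) :
    ∃ d f, gr S (DynamicRing.computed S ω W c) w = .walk d f ∧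
      gp S (DynamicRing.computed S ω W c) w = some d ∧ (c w).pos ≠ (c (e d)).pos ∧
      ∀ d' f', gr S c w = .walk d' f' → (c w).pos ≠ (c (e d')).pos → d' = d ∧ f' = f := by
  obtain ⟨d, f, hd, hf⟩ := exists_heads (ω := ω) h.third
  by_cases hs : (c w).pos = (c (e d)).pos
  · obtain ⟨u, hu⟩ := h.role d
    obtain ⟨h1, h2, -⟩ := computed_walker hW (h.running w) hd
      (Or.inr ⟨⟨e d, h.ne_third d, hs.symm, by rw [hu]; rfl⟩, rfl, rfl⟩)
    refine ⟨_, _, h1, h2, ?_, ?_⟩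
    · rw [hs]; exact (h.pos_ne_not hn hr d).symm
    · intro d' f' hw hne
      rcases hd with hd | ⟨hd, -⟩
      · rw [hd] at hw
        obtain ⟨rfl, rfl⟩ : d = d' ∧ f = f' := by simpa using hw
        exact (hne hs).elim
      · simp [hd] at hw
  · obtain ⟨h1, h2, -⟩ := computed_walker (W := W) hW (h.running w) hd (d' := d) (f' := f)
      (Or.inl ⟨fun j hj hp => by
        rcases eq_third h.ne h.ne_third j with ⟨g, rfl⟩ | rfl
        · obtain ⟨u, hu⟩ := h.role g
          rw [hu]
          intro hg
          obtain rfl : g = d := by simpa [Role.explores] using hg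
          exact hs hp.symm
        · exact (hj rfl).elim, rfl, rfl⟩)
    refine ⟨_, _, h1, h2, hs, ?_⟩
    intro d' f' hw hne
    rcases hd with hd | ⟨hd, -⟩
    · rw [hd] at hw
      simpa [eq_comm] using hw
    · simp [hd] at hw

/-- Only the walker can move. -/
theorem transported_blocked [NeZero n] (hn : 3 ≤ n) (h : Duo S V c e w r) (hr : r + 1 = n)
    (hb : Blocked S c e) {u : Bool → Bool} (hu : ∀ g, gr S c (e g) = .explore g (u g))
    (hV : V ⊆ V') (hp : ∀ i, (DynamicRing.relocate S cut c i).pos ∈ V') :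
    Known S V' (DynamicRing.transported S cut c) ∨
    Duo S V' (DynamicRing.transported S cut c) e w r ∧
    Blocked S (DynamicRing.transported S cut c) e ∧
    (∀ g, cut = some (edgeFrom (c (e g)).pos g)) ∧
    (goes S cut c w = none ∧ DynamicRing.transported S cut c = c ∨
      ∃ q, goes S cut c w = some q ∧
        ((∀ g, neighbour (c w).pos q ≠ (c (e g)).pos) ∧
            DynamicRing.transported S cut c = DynamicRing.relocate S cut c ∨
          ∃ g, neighbour (c w).pos q = (c (e g)).pos ∧
            gr S (DynamicRing.transported S cut c) w = .walk (!g) true ∧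
            gr S (DynamicRing.transported S cut c) (e g) = .explore g true ∧
            gr S (DynamicRing.transported S cut c) (e (!g)) = .explore (!g) (u (!g)) ∧
            ¬ (gr S c w = .walk g true ∧ u g = true))) := by
  rcases h.transported (by omega) hV hp with hk | ⟨h1, hr1, -⟩
  · exact Or.inl hk
  have hstay : ∀ g, goes S cut c (e g) = none := fun g => by
    by_contra hg
    have := gain_of_go hg
    cases g <;> omega
  rw [gain_of_stay (hstay true), gain_of_stay (hstay false)] at h1
  have hblk : Blocked S (DynamicRing.transported S cut c) e := fun g => by
    rw [transported_gp, gp_congr (relocate_stay (hstay g))]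
    exact hb g
  have hcut : ∀ g, cut = some (edgeFrom (c (e g)).pos g) := fun g =>
    goes_eq_none (hstay g) ((h.port g).resolve_left (hb g))
  have hcr : ∀ i j, crossed S cut c i j = false := fun i j => by
    rw [← Bool.not_eq_true, crossed_eq_true]
    rintro ⟨g, h2, h3, -⟩
    have : ∀ l d, goes S cut c l = some d → l = w := fun l d hl => by
      rcases eq_third h.ne h.ne_third l with ⟨g, rfl⟩ | hl'
      · simp [hstay g] at hl
      · exact hl'
    obtain rfl := this i _ h2
    obtain rfl := this j _ h3
    rw [h2] at h3
    simp at h3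
  have htr : DynamicRing.transported S cut c =
      DynamicRing.swapped S false (joined S cut c) (DynamicRing.relocate S cut c) := by
    rw [transported_eq]
    congr 1
    exact funext fun i => swapped_alone (hcr i)
  have hee : ∀ g, joined S cut c (e g) (e (!g)) = false := fun g => by
    rw [← Bool.not_eq_true, joined_eq_true]
    simp [hstay]
  have halone : (∀ g, joined S cut c w (e g) = false) → ∀ i j, joined S cut c i j = false := by
    intro hw i j
    rcases eq_third h.ne h.ne_third i with ⟨g, rfl⟩ | rfl
    · rcases eq_third h.ne h.ne_third j with ⟨g', rfl⟩ | rfl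
      · rcases eq_or_ne g' g with rfl | hne
        · exact joined_self _
        · rw [Bool.eq_not.2 hne]; exact hee g
      · rw [joined_comm]; exact hw g
    · rcases eq_third h.ne h.ne_third j with ⟨g', rfl⟩ | rfl
      · exact hw g'
      · exact joined_self _
  cases hq : goes S cut c w with
  | none =>
    refine Or.inr ⟨h1, hblk, hcut, Or.inl ⟨rfl, ?_⟩⟩
    rw [transported_of_apart hcr]
    · funext i
      rcases eq_third h.ne h.ne_third i with ⟨g, rfl⟩ | rfl
      · exact relocate_stay (hstay g)
      · exact relocate_stay hq
    · refine halone fun g => ?_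
      rw [← Bool.not_eq_true, joined_eq_true]
      simp [hstay, hq]
  | some q =>
    have hjoin : ∀ g, joined S cut c w (e g) = true ↔
        neighbour (c w).pos q = (c (e g)).pos := fun g => by
      rw [joined_eq_true, relocate_stay (hstay g), relocate_go hq]
      simp [hq, (h.ne_third g).symm]
    by_cases hmeet : ∃ g, neighbour (c w).pos q = (c (e g)).pos
    · obtain ⟨g, hg⟩ := hmeet
      have hj : joined S cut c w (e g) = true := (hjoin g).2 hg
      have hj' : joined S cut c w (e (!g)) = false := by
        rw [← Bool.not_eq_true, hjoin, hg]
        exact (h.pos_ne_not hn hr g).symm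
      have hrun : ∀ i, (DynamicRing.relocate S cut c i).halted = false := fun i => by
        rw [relocate_halted, h.running]
      have hrole : gr S (DynamicRing.relocate S cut c) (e g) = .explore g (u g) := by
        rw [relocate_gr, hu]
      have hport : (gp S (DynamicRing.relocate S cut c) (e g)).isSome = true := by
        rw [gp_congr (relocate_stay (hstay g)), Option.isSome_iff_ne_none]
        exact hb g
      have hw := swapped_walker (S := S) (c := DynamicRing.relocate S cut c) (x := false)
        (P := joined S cut c) (h.ne_third g).symm (h.ne_third (!g)).symm (h.ne g)
        (joined_self w) hj hj' (hrun w) (by rw [relocate_gr]; exact h.third) hrole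
      rw [hport, relocate_gr, ← htr] at hw
      split_ifs at hw with hc
      · exact Or.inl ⟨(h1.cover (by omega)), w, hw⟩
      · refine Or.inr ⟨h1, hblk, hcut, Or.inr ⟨q, rfl, Or.inr ⟨g, hg, hw, ?_, ?_, ?_⟩⟩⟩
        · rw [htr, swapped_explorer (h.ne_third g) (h.ne g) (h.ne_third _).symm (joined_self _)
            (by rw [joined_comm]; exact hj) (hee g) (hrun _) hrole
            (by rw [relocate_gr]; exact h.wanders_explores), hport]
        · rw [htr, gr_congr (swapped_alone fun j => ?_), relocate_gr, hu]
          rcases eq_third h.ne h.ne_third j with ⟨d, rfl⟩ | rfl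
          · rcases eq_or_ne d g with rfl | hne
            · rw [joined_comm]; exact hee _
            · rw [Bool.eq_not.2 hne]; exact joined_self _
          · rw [joined_comm]; exact hj'
        · rintro ⟨h2, h3⟩
          exact hc ⟨h2, h3, rfl⟩
    · push Not at hmeet
      refine Or.inr ⟨h1, hblk, hcut, Or.inr ⟨q, rfl, Or.inl ⟨hmeet, ?_⟩⟩⟩
      refine transported_of_apart hcr (halone fun g => ?_)
      rw [← Bool.not_eq_true, hjoin]
      exact hmeet g

/-- A walker that moves towards an explorer. -/
theorem progress_of_go [NeZero n] (hn : 3 ≤ n) (h : Duo S V c e w r) (hr : r + 1 = n)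
    (hb : Blocked S c e) {u : Bool → Bool} (hu : ∀ g, gr S c (e g) = .explore g (u g))
    {d f : Bool} (hw : gr S c w = .walk d f) (hgp : gp S c w = some d)
    (hne : (c w).pos ≠ (c (e d)).pos)
    (hV : V ⊆ V') (hp : ∀ i, (DynamicRing.relocate S cut c i).pos ∈ V') :
    ∃ i' k', k' < 2 + level f (u d) (u (!d)) * n + gap (c w).pos (c (e d)).pos d ∧
      Good S ω V' (DynamicRing.transported S cut c) i' k' := by
  have hgap := gap_neighbour_left hn hne d
  rcases h.transported_blocked hn hr hb hu hV hp with hk | ⟨h1, h2, h3, h4⟩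
  · obtain ⟨i, hi⟩ := hk.good (ω := ω)
    exact ⟨i, 1, by omega, hi⟩
  have hstay : ∀ g, goes S cut c (e g) = none := fun g => by
    by_contra hg
    rcases h.goes_eq (cut := cut) g with h5 | h5
    · exact hg h5
    · exact (goes_eq_some.1 h5).2 (h3 g)
  have hpos : ∀ g, (DynamicRing.transported S cut c (e g)).pos = (c (e g)).pos := fun g => by
    rw [transported_pos, relocate_stay (hstay g)]
  -- The missing edge is the one ahead of `e d`, which in direction `d` blocks only that node.
  have hgo : goes S cut c w = some d := by
    refine goes_eq_some.2 ⟨hgp, fun hcut => hne ?_⟩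
    rw [h3 d] at hcut
    exact (edgeFrom_injective d (by simpa using hcut)).symm
  have hwpos : (DynamicRing.transported S cut c w).pos = neighbour (c w).pos d := by
    rw [transported_pos, relocate_go hgo]
  have hwgp : gp S (DynamicRing.transported S cut c) w = none := by
    rw [transported_gp, relocate_gp_of_go hgo]
  rcases h4 with ⟨h4, -⟩ | ⟨q, hq, h4⟩
  · simp [hgo] at h4
  obtain rfl : d = q := by simpa [hgo] using hq
  rcases h4 with ⟨h5, h6⟩ | ⟨g, h5, h6, h7, h8, h9⟩
  · refine ⟨w, _, ?_, .nearing e w r d f u h1 hr h2 ?_ (Or.inl hwgp) ?_ ?_⟩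
    · rw [hwpos, hpos]; omega
    · rw [h6, relocate_gr, hw]
    · intro g; rw [h6, relocate_gr, hu]
    · rw [hwpos, hpos]; exact h5 d
  -- In direction `d`, the node of `e (!d)` can be entered only from the node of `e d`, over the
  -- missing edge.
  · obtain rfl : g = d := by
      by_contra hgd
      rw [Bool.eq_not.2 hgd, ← h.pos_not hr d] at h5
      exact hne (neighbour_injective d h5)
    have hu' : ∀ b, gr S (DynamicRing.transported S cut c) (e b) =
        .explore b (if b = g then true else u (!g)) := fun b => by
      by_cases hbg : b = g
      · simp [hbg, h7]
      · simp [Bool.eq_not.2 hbg, h8]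
    refine ⟨w, _, ?_, .nearing e w r (!g) true _ h1 hr h2 h6 (Or.inl hwgp) hu' ?_⟩
    · have h10 := gap_lt (DynamicRing.transported S cut c w).pos
        (DynamicRing.transported S cut c (e (!g))).pos (!g)
      -- The meeting sets the walker's flag and that of `e g`. As it did not lead to termination,
      -- the level goes from 2 to 1 or from 1 to 0; the lost `n` pays for the new distance, which is
      -- less than `n`.
      have h11 : level true (if (!g) = g then true else u (!g))
          (if (!!g) = g then true else u (!g)) + 1 ≤ level f (u g) (u (!g)) := by
        rw [hw] at h9
        revert h9
        simp only [Role.walk.injEq]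
        generalize u g = a
        generalize u (!g) = b
        clear * -
        revert a b f g
        decide
      have h12 := Nat.mul_le_mul_right n h11
      rw [add_mul] at h12
      omega
    · rw [hwpos, hpos, h5]
      exact (h.pos_ne_not hn hr g).symm

theorem progress_blocked [NeZero n] (hn : 3 ≤ n) (h : Duo S V c e w r) (hr : r + 1 = n)
    (hb : Blocked S c e) (hV : V ⊆ V')
    (hp : ∀ i, (DynamicRing.relocate S cut (DynamicRing.computed S ω W c) i).pos ∈ V') :
    Progress S ω V' W (DynamicRing.transported S cut (DynamicRing.computed S ω W c)) w
      (3 * n + 2) := by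
  have h1 : Duo S V (DynamicRing.computed S ω W c) e w r := h.computed
  have hb1 : Blocked S (DynamicRing.computed S ω W c) e := h.blocked_computed hb
  choose u hu using h1.role
  by_cases hW : w ∈ W
  · obtain ⟨d, f, h2, h3, h4, -⟩ := h.walker_computed (ω := ω) hn hr hW
    obtain ⟨i, k, hk, hG⟩ := h1.progress_of_go (ω := ω) hn hr hb1 hu h2 h3 (by simpa using h4) hV hp
    refine Or.inl ⟨i, k, hk.trans_le ?_, hG⟩
    have := gap_lt (DynamicRing.computed S ω W c w).pos (DynamicRing.computed S ω W c (e d)).pos d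
    have := Nat.mul_le_mul_right n (level_le f (u d) (u (!d)))
    omega
  · rcases h1.transported_blocked hn hr hb1 hu hV hp with hk | ⟨h2, h3, -⟩
    · exact hk.progress (by omega)
    · exact Or.inr ⟨hW, .blocked e w r h2 hr h3⟩

/-- A walker already on its port moves even if asleep; otherwise nothing changes until its
activation. The explorers stay blocked, so their flags survive their own activations. -/
theorem progress_nearing [NeZero n] (hn : 3 ≤ n) (h : Duo S V c e w r) (hr : r + 1 = n)
    (hb : Blocked S c e) {u : Bool → Bool} (hu : ∀ g, gr S c (e g) = .explore g (u g))
    {d f : Bool} (hw : gr S c w = .walk d f) (hgp : gp S c w = none ∨ gp S c w = some d)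
    (hne : (c w).pos ≠ (c (e d)).pos) (hV : V ⊆ V')
    (hp : ∀ i, (DynamicRing.relocate S cut (DynamicRing.computed S ω W c) i).pos ∈ V') :
    Progress S ω V' W (DynamicRing.transported S cut (DynamicRing.computed S ω W c)) w
      (2 + level f (u d) (u (!d)) * n + gap (c w).pos (c (e d)).pos d) := by
  have h1 : Duo S V (DynamicRing.computed S ω W c) e w r := h.computed
  have hb1 : Blocked S (DynamicRing.computed S ω W c) e := h.blocked_computed hb
  have hu1 : ∀ g, gr S (DynamicRing.computed S ω W c) (e g) = .explore g (u g) := fun g => by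
    obtain ⟨v, v', h2, h3, -, h4⟩ := (h.explorer_computed (ω := ω) (W := W) g).2.2.2.2
    rw [h3, h4 (hb g)]
    rw [hu] at h2
    exact h2.symm
  have hgo : gr S (DynamicRing.computed S ω W c) w = .walk d f →
      gp S (DynamicRing.computed S ω W c) w = some d →
      Progress S ω V' W (DynamicRing.transported S cut (DynamicRing.computed S ω W c)) w
      (2 + level f (u d) (u (!d)) * n + gap (c w).pos (c (e d)).pos d) := fun h2 h3 => by
    have := h1.progress_of_go (ω := ω) hn hr hb1 hu1 h2 h3 (by simpa using hne) hV hp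
    simp only [computed_pos] at this
    exact Or.inl this
  by_cases hW : w ∈ W
  · obtain ⟨d', f', h2, h3, -, h5⟩ := h.walker_computed (ω := ω) hn hr hW
    obtain ⟨rfl, rfl⟩ := h5 d f hw hne
    exact hgo h2 h3
  · have hc := computed_asleep (S := S) (c := c) (ω := ω) hW
    rcases hgp with hgp | hgp
    · rcases h1.transported_blocked hn hr hb1 hu1 hV hp with hk | ⟨h2, h3, -, h4⟩
      · have := gap_neighbour_left hn hne d
        exact hk.progress (by omega)
      · have hs : goes S cut (DynamicRing.computed S ω W c) w = none := by
          simp [goes, gp_congr hc, hgp]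
        rcases h4 with ⟨-, h4⟩ | ⟨q, h4, -⟩
        · rw [h4] at h2 h3 ⊢
          have := Good.nearing (ω := ω) e w r d f u h2 hr h3 (by rw [gr_congr hc, hw])
            (by rw [gp_congr hc]; exact Or.inl hgp) hu1 (by simpa using hne)
          simp only [computed_pos] at this
          exact Or.inr ⟨hW, this⟩
        · simp [hs] at h4
    · exact hgo (by rw [gr_congr hc, hw]) (by rw [gp_congr hc, hgp])

end Duo

/-! ### One round -/

theorem transported_finished {i : Fin 3} (h : gr S c i = .finished) :
    gr S (transported S cut c) i = .finished := by
  rw [transported_eq]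
  exact swapped_finished (swapped_finished (by rw [relocate_gr, h]))

theorem transported_halted (i : Fin 3) :
    (transported S cut c i).halted = (c i).halted := by
  rw [transported_eq, swapped_halted, swapped_halted, relocate_halted]

theorem Good.step (hn : 3 ≤ n) {i : Fin 3} {k : ℕ} (h : Good S ω V c i k) (hN : Named S c)
    (hV : V ⊆ V') (hp : ∀ i, (transported S cut (computed S ω W c) i).pos ∈ V') :
    k = 0 ∧ Good S ω V' (transported S cut (computed S ω W c)) i 0 ∨
      Progress S ω V' W (transported S cut (computed S ω W c)) i k := by
  have : NeZero n := ⟨by omega⟩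
  simp only [transported_pos] at hp
  cases h with
  | halted i j hU hj =>
    exact Or.inl ⟨rfl, .halted i j (Set.eq_univ_of_univ_subset (hU ▸ hV))
      (by rw [transported_halted, computed_halted_of_halted hj])⟩
  | known i hU hi =>
    right
    have hU' := Set.eq_univ_of_univ_subset (hU ▸ hV)
    obtain ⟨h1, h2⟩ := computed_finished (ω := ω) (W := W) hi
    by_cases hW : i ∈ W
    · exact Or.inl ⟨i, 0, one_pos, .halted i i hU' (by rw [transported_halted, h2 hW])⟩
    · exact Or.inr ⟨hW, .known i hU' (transported_finished h1)⟩
  | nearing e w r d f u hD hr hb hw hgp hu hne =>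
    exact Or.inr (hD.progress_nearing hn hr hb hu hw hgp hne hV hp)
  | blocked e w r hD hr hb => exact Or.inr (hD.progress_blocked hn hr hb hV hp)
  | duo e w r g hD hr hg => exact Or.inr (hD.progress hr hg hV hp)
  | trio z g i hT hi => exact Or.inr (hT.progress hn hN hi hp)

end

section

variable {n : ℕ} {S : Setup n} {c : Config n (ℕ × Role)}
  {ω : Coins} {adv : Adversary n (ℕ × Role)}

/-! ### The execution -/

/-- The nodes visited by time `t`. -/
def visitedBy (S : Setup n) (adv : Adversary n (ℕ × Role)) (ω : Coins) (t : ℕ) : Set (ZMod n) :=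
  {v | ∃ s ≤ t, ∃ i, (config ringAlgorithm S adv ω s i).pos = v}

theorem config_succ (t : ℕ) : ∃ cut, config ringAlgorithm S adv ω (t + 1) =
    transported S cut (computed S ω (awake ringAlgorithm S adv ω t)
      (config ringAlgorithm S adv ω t)) := ⟨_, rfl⟩

theorem named_transported {cut : Option (ZMod n)} (h : Named S c) :
    Named S (transported S cut c) := fun i => by
  rw [transported_eq, swapped_id, swapped_id, relocate_id, h]

theorem named_config (t : ℕ) : Named S (config ringAlgorithm S adv ω t) := by
  induction t with
  | zero => intro i; exact swapped_id i
  | succ t ih =>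
    obtain ⟨cut, h⟩ := config_succ (S := S) (adv := adv) (ω := ω) t
    rw [h]
    exact named_transported fun i => by rw [computed_id, ih]

/-- The robots do not all get the same global direction from their first random bits. -/
def Mixed (S : Setup n) (ω : Coins) : Prop :=
  ∀ g, ∃ i, ω (i, 0) ≠ turn (S.chir i) g

theorem Mixed.exists_odd (h : Mixed S ω) : ∃ z g, ∀ i,
    turn (S.chir i) (ω (i, 0)) = if i = z then !g else g := by
  have h' : ∀ g, ∃ i, turn (S.chir i) (ω (i, 0)) ≠ g := fun g => by
    obtain ⟨i, hi⟩ := h g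
    exact ⟨i, fun hg => hi (by rw [← hg, turn_turn])⟩
  generalize hf : (fun i => turn (S.chir i) (ω (i, 0))) = f
  have hf' : ∀ i, turn (S.chir i) (ω (i, 0)) = f i := fun i => congrFun hf i
  simp only [hf'] at h' ⊢
  clear hf hf' h
  revert f
  decide

/-- Robots sharing a node found a pair of explorers at once; mixed directions are needed only for
three distinct starting nodes. -/
theorem good_initial (hn : 3 ≤ n) (h : Mixed S ω) :
    ∃ i k, Good S ω (visitedBy S adv ω 0) (config ringAlgorithm S adv ω 0) i k := by
  have : NeZero n := ⟨by omega⟩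
  set c : Config n (ℕ × Role) := fun i => ⟨S.start i, none, (S.ids i, .fresh), false, 0⟩ with hc
  set P : Fin 3 → Fin 3 → Bool :=
    fun i j => decide (i ≠ j) && decide (S.start i = S.start j) with hP
  have h0 : config ringAlgorithm S adv ω 0 = swapped S false P c := rfl
  have hPtrue : ∀ i j, P i j = true ↔ i ≠ j ∧ (c i).pos = (c j).pos := fun i j => by
    simp [hP, hc]
  by_cases hex : ∃ i j, P i j = true
  · obtain ⟨i, j, hij⟩ := hex
    obtain ⟨hne, hp⟩ := (hPtrue i j).1 hij
    have hG : Gathered S (visitedBy S adv ω 0) c P :=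
      { running := fun i => rfl
        wanders := fun i => rfl
        meets := hPtrue
        port := fun i j _ _ => Or.inl rfl
        visited := fun i => ⟨0, le_rfl, i, by rw [h0, swapped_pos]⟩ }
    obtain ⟨e, w, g, hD, hg⟩ := hG.found (fun i => rfl) hne hp
    rw [h0]
    exact ⟨_, _, .duo e w 0 g hD (by omega) hg⟩
  · have hno : ∀ i j, P i j = false := by simpa using hex
    have h1 : config ringAlgorithm S adv ω 0 = c := by
      rw [h0]; exact funext fun i => swapped_alone (hno i)
    obtain ⟨z, g, hz⟩ := h.exists_odd
    have hT : Trio S ω c z g :=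
      { running := fun i => rfl
        apart := fun i j hp => by
          by_contra hij
          exact absurd ((hPtrue i j).2 ⟨hij, hp⟩) (by simp [hno])
        heads := fun i => ⟨false, Or.inr ⟨rfl, hz i, rfl⟩⟩
        port := fun i => Or.inl rfl
        active := fun i hi => (hi rfl).elim }
    rw [h1]
    exact ⟨_, _, .trio z g 0 hT rfl⟩

theorem good_succ (hn : 3 ≤ n) {t : ℕ} {i : Fin 3} {k : ℕ}
    (h : Good S ω (visitedBy S adv ω t) (config ringAlgorithm S adv ω t) i k) :
    k = 0 ∧ Good S ω (visitedBy S adv ω (t + 1)) (config ringAlgorithm S adv ω (t + 1)) i 0 ∨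
      Progress S ω (visitedBy S adv ω (t + 1)) (awake ringAlgorithm S adv ω t)
        (config ringAlgorithm S adv ω (t + 1)) i k := by
  obtain ⟨cut, hc⟩ := config_succ (S := S) (adv := adv) (ω := ω) t
  have hV : visitedBy S adv ω t ⊆ visitedBy S adv ω (t + 1) := by
    rintro v ⟨s, hs, hv⟩
    exact ⟨s, by omega, hv⟩
  have hp : ∀ i, (config ringAlgorithm S adv ω (t + 1) i).pos ∈ visitedBy S adv ω (t + 1) :=
    fun i => ⟨t + 1, le_rfl, i, rfl⟩
  rw [hc] at hp ⊢
  exact h.step hn (named_config t) hV hp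

theorem good_config (hn : 3 ≤ n) (h : Mixed S ω) (t : ℕ) :
    ∃ i k, Good S ω (visitedBy S adv ω t) (config ringAlgorithm S adv ω t) i k := by
  induction t with
  | zero => exact good_initial hn h
  | succ t ih =>
    obtain ⟨i, k, hG⟩ := ih
    rcases good_succ hn hG with ⟨-, h1⟩ | ⟨i', k', -, h1⟩ | ⟨-, h1⟩
    exacts [⟨_, _, h1⟩, ⟨_, _, h1⟩, ⟨_, _, h1⟩]

/-! ### Termination and safety from the rank. -/

theorem good_next_window (hn : 3 ≤ n) {t t' : ℕ}
    (hw : ∀ i, ∃ s, t ≤ s ∧ s < t' ∧ i ∈ awake ringAlgorithm S adv ω s) {i : Fin 3} {k : ℕ}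
    (h : Good S ω (visitedBy S adv ω t) (config ringAlgorithm S adv ω t) i (k + 1)) :
    ∃ i' k', k' ≤ k ∧ Good S ω (visitedBy S adv ω t') (config ringAlgorithm S adv ω t') i' k' := by
  obtain ⟨s, hts, hst, hi⟩ := hw i
  have hstay : ∀ m, t + m ≤ s + 1 → (∃ i' k', k' ≤ k ∧
      Good S ω (visitedBy S adv ω (t + m)) (config ringAlgorithm S adv ω (t + m)) i' k') ∨
      t + m ≤ s ∧
        Good S ω (visitedBy S adv ω (t + m)) (config ringAlgorithm S adv ω (t + m)) i (k + 1) := by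
    intro m
    induction m with
    | zero => exact fun _ => Or.inr ⟨hts, h⟩
    | succ m ih =>
      intro hm
      rcases ih (by omega) with ⟨i', k', hk, h1⟩ | ⟨-, h1⟩
      · left
        rcases good_succ hn h1 with ⟨-, h1⟩ | ⟨i', k', h2, h1⟩ | ⟨-, h1⟩
        exacts [⟨_, _, by omega, h1⟩, ⟨_, _, by omega, h1⟩, ⟨_, _, hk, h1⟩]
      · rcases good_succ hn h1 with ⟨h2, -⟩ | ⟨i', k', h2, h1⟩ | ⟨h2, h1⟩
        · omega
        · exact Or.inl ⟨_, _, by omega, h1⟩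
        · refine Or.inr ⟨?_, h1⟩
          by_contra hs
          obtain rfl : s = t + m := by omega
          exact h2 hi
  have hlater : ∀ m, ∃ i' k', k' ≤ k ∧ Good S ω (visitedBy S adv ω (s + 1 + m))
      (config ringAlgorithm S adv ω (s + 1 + m)) i' k' := by
    intro m
    induction m with
    | zero =>
      rcases hstay (s + 1 - t) (by omega) with h1 | ⟨h1, -⟩
      · rwa [show t + (s + 1 - t) = s + 1 by omega] at h1
      · omega
    | succ m ih =>
      obtain ⟨i', k', hk, h1⟩ := ih
      rcases good_succ hn h1 with ⟨-, h1⟩ | ⟨i', k', h2, h1⟩ | ⟨-, h1⟩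
      exacts [⟨_, _, by omega, h1⟩, ⟨_, _, by omega, h1⟩, ⟨_, _, hk, h1⟩]
  have := hlater (t' - (s + 1))
  rwa [show s + 1 + (t' - (s + 1)) = t' by omega] at this

/-- The windows need not have equal length. This covers both a finite activation gap and mere
fairness, where window lengths may be unbounded. -/
theorem terminatedBy_of_windows (hn : 3 ≤ n) (h : Mixed S ω) {τ : ℕ → ℕ} (hτ0 : τ 0 = 0)
    (hw : ∀ m i, ∃ s, τ m ≤ s ∧ s < τ (m + 1) ∧ i ∈ awake ringAlgorithm S adv ω s) :
    TerminatedBy ringAlgorithm S adv ω (τ (13 * n)) := by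
  have key : ∀ m, ∃ i k, k ≤ 13 * n - m ∧
      Good S ω (visitedBy S adv ω (τ m)) (config ringAlgorithm S adv ω (τ m)) i k := by
    intro m
    induction m with
    | zero =>
      obtain ⟨i, k, hG⟩ := good_initial (adv := adv) hn h
      rw [hτ0]
      exact ⟨i, k, hG.le hn, hG⟩
    | succ m ih =>
      obtain ⟨i, k, hk, hG⟩ := ih
      cases k with
      | succ k =>
        obtain ⟨i', k', hk', hG'⟩ := good_next_window hn (hw m) hG
        exact ⟨i', k', by omega, hG'⟩
      | zero =>
        have : ∀ l, Good S ω (visitedBy S adv ω (τ m + l))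
            (config ringAlgorithm S adv ω (τ m + l)) i 0 := by
          intro l
          induction l with
          | zero => exact hG
          | succ l ih =>
            rcases good_succ hn ih with ⟨-, h1⟩ | ⟨i', k', h2, -⟩ | ⟨-, h1⟩
            · exact h1
            · omega
            · exact h1
        obtain ⟨s, h1, h2, -⟩ := hw m 0
        have := this (τ (m + 1) - τ m)
        rw [show τ m + (τ (m + 1) - τ m) = τ (m + 1) by omega] at this
        exact ⟨i, 0, Nat.zero_le _, this⟩
  obtain ⟨i, k, hk, hG⟩ := key (13 * n)
  obtain rfl : k = 0 := by omega
  generalize hz : 0 = z at hG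
  cases hG with
  | halted i j hV hj => exact ⟨j, hj⟩
  | _ => omega

theorem computed_halted {W : Finset (Fin 3)} {i : Fin 3} (hr : gr S c i ≠ .finished)
    (hh : (c i).halted = false) : (computed S ω W c i).halted = false := by
  by_cases hW : i ∈ W
  · cases hi : gr S c i with
    | finished => exact (hr hi).elim
    | explore g u => exact (computed_explorer hW hh hi).2.2
    | _ =>
      obtain ⟨-, -, -, -, h, -⟩ := computed_wanders (ω := ω) hW hh (by rw [hi]; rfl)
      exact h
  · rw [computed_asleep hW, hh]

/-- A robot halts only if its role was `finished` before the round, and among the good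
configurations only `halted` and `known` allow a finished or halted robot; both have all nodes
visited. -/
theorem exploredBy_of_terminatedBy (hn : 3 ≤ n) (h : Mixed S ω) {t : ℕ}
    (ht : TerminatedBy ringAlgorithm S adv ω (t + 1)) : ExploredBy ringAlgorithm S adv ω t := by
  obtain ⟨i, k, hG⟩ := good_config (adv := adv) hn h t
  have hV : visitedBy S adv ω t = Set.univ → ExploredBy ringAlgorithm S adv ω t := fun hV v => by
    have : v ∈ visitedBy S adv ω t := hV ▸ Set.mem_univ v
    exact this
  have hno : (∀ i, (config ringAlgorithm S adv ω t i).halted = false) →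
      (∀ i, gr S (config ringAlgorithm S adv ω t) i ≠ .finished) → False := fun h1 h2 => by
    obtain ⟨j, hj⟩ := ht
    obtain ⟨cut, hc⟩ := config_succ (S := S) (adv := adv) (ω := ω) t
    rw [hc, transported_halted, computed_halted (h2 j) (h1 j)] at hj
    simp at hj
  have hduo : ∀ {e w r}, Duo S (visitedBy S adv ω t) (config ringAlgorithm S adv ω t) e w r →
      False := fun hD => by
    refine hno hD.running fun i hi => ?_
    rcases eq_third hD.ne hD.ne_third i with ⟨g, rfl⟩ | rfl
    · obtain ⟨u, hu⟩ := hD.role g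
      simp [hu] at hi
    · have := hD.third
      simp [hi, Role.wanders] at this
  cases hG with
  | halted i j hU => exact hV hU
  | known i hU => exact hV hU
  | nearing e w r d f u hD => exact (hduo hD).elim
  | blocked e w r hD => exact (hduo hD).elim
  | duo e w r g hD => exact (hduo hD).elim
  | trio z g i hT =>
    refine (hno hT.running fun i hi => ?_).elim
    obtain ⟨f, hf⟩ := hT.heads i
    have := hf.wanders
    simp [hi, Role.wanders] at this

/-! ### The number of steps -/

theorem steps_le (alg : Algorithm) (S : Setup n) (adv : Adversary n alg.Mem) (ω : Coins) (t : ℕ) :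
    steps alg S adv ω t ≤ 3 * t := by
  calc steps alg S adv ω t ≤ ∑ _s ∈ Finset.range t, 3 :=
        Finset.sum_le_sum fun s _ => (Finset.card_le_univ _).trans (by simp)
    _ = 3 * t := by simp [mul_comm]

theorem exists_awake_of_gap {alg : Algorithm} {adv : Adversary n alg.Mem}
    (hfair : IsFair alg S adv ω) {F : ℕ} (hF : activationGap alg S adv ω = F) (t : ℕ) (i : Fin 3) :
    ∃ s, t ≤ s ∧ s < t + F ∧ i ∈ awake alg S adv ω s := by
  classical
  obtain ⟨r, hr, hrA, hmax⟩ : ∃ r ≤ t, ActivatedIn alg S adv ω i r ∧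
      ∀ q, r < q → q ≤ t → ¬ ActivatedIn alg S adv ω i q := by
    refine ⟨Nat.findGreatest (ActivatedIn alg S adv ω i) t, Nat.findGreatest_le t,
      Nat.findGreatest_spec (P := ActivatedIn alg S adv ω i) (Nat.zero_le t) trivial,
      fun q h1 h2 => Nat.findGreatest_is_greatest h1 h2⟩
  have hex : ∃ s, t ≤ s ∧ i ∈ awake alg S adv ω s := hfair i t
  obtain ⟨h1, h2⟩ := Nat.find_spec hex
  refine ⟨Nat.find hex, h1, ?_, h2⟩
  -- Being awake at time `s` is activation in round `s + 1`. The last activation round `r ≤ t` and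
  -- this one are consecutive, so `s + 1 ≤ r + F ≤ t + F`.
  have hle : (((Nat.find hex + 1) - r : ℕ) : ℕ∞) ≤ activationGap alg S adv ω := by
    refine le_iSup_of_le i (le_iSup_of_le r (le_iSup_of_le (Nat.find hex + 1)
      (le_iSup_of_le ⟨by omega, hrA, h2, ?_⟩ le_rfl)))
    intro q hq1 hq2 hq
    rcases Nat.lt_or_ge t q with hq3 | hq3
    · cases q with
      | zero => omega
      | succ q => exact Nat.find_min hex (by omega : q < Nat.find hex) ⟨by omega, hq⟩
    · exact hmax q hq1 hq3 hq
  rw [hF, Nat.cast_le] at hle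
  omega

theorem exploresWithin_of_mixed (hn : 3 ≤ n) (hfair : IsFair ringAlgorithm S adv ω)
    (h : Mixed S ω) : ExploresWithin ringAlgorithm S adv ω
      (((40 : ℕ) : ℕ∞) * activationGap ringAlgorithm S adv ω * (n : ℕ∞)) := by
  refine ⟨fun t ht => exploredBy_of_terminatedBy hn h ht, ?_⟩
  cases hF : activationGap ringAlgorithm S adv ω with
  | top =>
    -- With an infinite gap the step bound is void, but termination at a finite time must still be
    -- shown: each window ends when every robot has been awake.
    choose s hs using hfair
    have hτ := terminatedBy_of_windows (τ := fun m => Nat.rec 0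
      (fun _ t => (Finset.univ.sup fun i => s i t) + 1) m) hn h rfl fun m i =>
        ⟨s i _, (hs i _).1, Nat.lt_succ_of_le (Finset.le_sup (f := fun i => s i _)
          (Finset.mem_univ i)), (hs i _).2⟩
    refine ⟨_, hτ, ?_⟩
    rw [ENat.mul_top (by simp), ENat.top_mul (by simp; omega)]
    exact le_top
  | coe F =>
    have hτ := terminatedBy_of_windows (τ := fun m => m * F) hn h (by simp) fun m i => by
      obtain ⟨s, h1, h2, h3⟩ := exists_awake_of_gap hfair hF (m * F) i
      exact ⟨s, h1, by simpa [add_mul] using h2, h3⟩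
    refine ⟨_, hτ, ?_⟩
    have := steps_le ringAlgorithm S adv ω (13 * n * F)
    -- Three robots during `13 * n` windows of length `F` make at most `39 * n * F` moves.
    have h2 : 3 * (13 * n * F) ≤ 40 * F * n := by nlinarith [Nat.zero_le (n * F)]
    exact_mod_cast this.trans h2

/-! ### The probability -/

open MeasureTheory in
theorem coinLaw_cylinder (b : Fin 3 → Bool) :
    coinLaw {ω | ∀ i, ω (i, 0) = b i} = (8 : ℝ≥0∞)⁻¹ := by
  have hset : {ω : Coins | ∀ i, ω (i, 0) = b i} =
      Set.pi ((Finset.univ.image fun i : Fin 3 => (i, 0) : Finset (Fin 3 × ℕ)) : Set (Fin 3 × ℕ))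
        (fun p => {b p.1}) := by
    ext ω
    simp [Set.mem_pi]
  rw [hset, coinLaw, Measure.infinitePi_pi _ (fun _ _ => MeasurableSet.singleton _),
    Finset.prod_image (fun i _ j _ h => (Prod.mk.inj h).1)]
  simp only [PMF.toMeasure_apply_singleton _ _ (MeasurableSet.singleton _),
    PMF.uniformOfFintype_apply, Finset.prod_const, Finset.card_univ, Fintype.card_bool,
    Fintype.card_fin]
  rw [← ENNReal.inv_pow]
  norm_num

-- The complement consists of two cylinders, one for each common global direction, each fixing three
-- bits and of measure `1/8`. Private orientations only change which bits are fixed.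
open MeasureTheory in
theorem three_quarters_le_mixed (S : Setup n) : (3 / 4 : ℝ≥0∞) ≤ coinLaw {ω | Mixed S ω} := by
  have hprob : IsProbabilityMeasure coinLaw := by unfold coinLaw; infer_instance
  set A : Bool → Set Coins := fun g => {ω | ∀ i, ω (i, 0) = turn (S.chir i) g} with hA
  have hset : {ω | Mixed S ω} = (A true ∪ A false)ᶜ := by
    ext ω
    simp [Mixed, hA, and_comm]
  have hmeas : ∀ g, MeasurableSet (A g) := fun g => by
    have : A g = ⋂ i, (fun ω : Coins => ω (i, 0)) ⁻¹' {turn (S.chir i) g} := by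
      ext ω; simp [hA]
    rw [this]
    exact MeasurableSet.iInter fun i => measurable_pi_apply _ (MeasurableSet.singleton _)
  rw [hset, prob_compl_eq_one_sub ((hmeas _).union (hmeas _))]
  have hle : coinLaw (A true ∪ A false) ≤ 4⁻¹ := by
    refine (measure_union_le _ _).trans ?_
    rw [hA, coinLaw_cylinder, coinLaw_cylinder]
    rw [← ENNReal.toReal_le_toReal (by simp) (by simp), ENNReal.toReal_add (by simp) (by simp)]
    norm_num
  refine le_trans ?_ (tsub_le_tsub_left hle 1)
  rw [← ENNReal.toReal_le_toReal (by finiteness) (by finiteness),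
    ENNReal.toReal_sub_of_le (by norm_num) (by simp)]
  norm_num

end

end DynamicRing

theorem mainTheorem7 :
    ∃ (alg : DynamicRing.Algorithm) (K : ℕ),
      ∀ (n : ℕ), 3 ≤ n → ∀ (S : DynamicRing.Setup n) (adv : DynamicRing.Adversary n alg.Mem),
        (∀ ω, DynamicRing.IsFair alg S adv ω) →
          (∀ k : ℕ, (∀ i, S.ids i < 2 ^ k) → ∀ ω t i,
            Nat.size (Encodable.encode (DynamicRing.config alg S adv ω t i).mem) ≤
              K * (Nat.log 2 n + k)) ∧
          (3 / 4 : ℝ≥0∞) ≤ DynamicRing.coinLaw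
            {ω | DynamicRing.ExploresWithin alg S adv ω
              ((K : ℕ∞) * DynamicRing.activationGap alg S adv ω * (n : ℕ∞))} := by
  refine ⟨DynamicRing.ringAlgorithm, 40, fun n hn S adv hfair => ⟨fun k hk ω t i => ?_, ?_⟩⟩
  -- Since the logarithm is at least one, the constant 8 in `size_encode_le` is absorbed into `40 *
  -- Nat.log 2 n`.
  · have hlog : 0 < Nat.log 2 n := Nat.log_pos (by norm_num) (by omega)
    have hid : (DynamicRing.config DynamicRing.ringAlgorithm S adv ω t i).mem.1 < 2 ^ k := by
      rw [DynamicRing.named_config t i]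
      exact hk i
    have := DynamicRing.size_encode_le hid
    refine this.trans ?_
    omega
  · exact (DynamicRing.three_quarters_le_mixed S).trans (MeasureTheory.measure_mono fun ω hω =>
      DynamicRing.exploresWithin_of_mixed hn (hfair ω) hω)
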